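/- For a positive integer $n$ let $$\mathcal F(w,x)=\sum_{d\ge0}x^d\,\frac{\prod_{r=1}^{nd}(nw+r)}{\prod_{r=1}^{d}\bigl((w+r)^n-w^n\bigr)}\in\mathbb Q(w)[[x]],\qquad L=L(x)=(1-n^nx)^{-1/n}\in\mathbb Q[[x]].$$ There are unique power series $\mu\in x\,\mathbb Q[[x]]$ and $\Phi_s\in\mathbb Q[[x]]$ ($s\ge0$), depending on $n$, such that $$\mathcal F(w,x)\sim e^{\mu(x)w}\sum_{s\ge0}\Phi_s(x)\,w^{-s}\qquad(w\to\infty),$$ meaning that for every $d$ the coefficient of $x^d$ in $e^{-\mu(x)w}\mathcal F(w,x)$, a rational function of $w$, has the expansion as $w\to\infty$ in powers of $w^{-1}$ given by the coefficients of $x^d$ in the $\Phi_s$. Let $D=x\,d/dx$. Define $\mathcal H_{m,j}\in\mathbb Q[X]$ by $\mathcal H_{0,j}=\delta_{0,j}$ and $$\mathcal H_{m,j}=\mathcal H_{m-1,j}+(X-1)\Bigl(X\frac{d}{dX}+\frac{m-j}{n}\Bigr)\mathcal H_{m-1,j-1}\qquad(m\ge1),$$ where $\mathcal H_{m-1,j-1}=0$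 if $j=0$. Let $S_r(n)$ be the $r$-th elementary symmetric function of $1,2,\dots,n$, and for $0\le k\le n$ let $\mathcal L_k$ be the differential operator on $\mathbb Q[[x]]$ $$\mathcal L_k=\sum_{i=0}^k\Bigl(\binom ni\mathcal H_{n-i,k-i}(L^n)-(L^n-1)\sum_{r=1}^{k-i}\binom{n-r}{i}\frac{S_r(n)}{n^r}\,\mathcal H_{n-i-r,k-i-r}(L^n)\Bigr)D^i .$$ Then: (i) For every $n\ge1$, the sequence $(\Phi_s)_{s\ge0}$ satisfies, and is the only sequence in $\mathbb Q[[x]]$ satisfying, the differential equations $$\sum_{k=1}^{n}L^{1-k}\,\mathcal L_k(\Phi_{s+1-k})=0\qquad(s\ge0)$$ (with $\Phi_r=0$ for $r<0$) together with the initial conditions $\Phi_s(0)=\delta_{0,s}$. (ii) For every $n\ge1$ and $s\ge0$, $\Phi_s\in L\,\mathbb Q[L]$. (iii) For every $s\ge0$ there is $\Psi_s(a,X,Y,Z)\in\mathbb Q(a)[X,Y,Z]$, independent of $n$, such that for every integer $n\ge1$ no coefficient of $\Psi_s$ has a pole at $a=n$ and $$\Phi_s(x)=\Psi_s\bigl(n,L(x),L(x)^{-1},L(x)^n\bigr).$$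 -/

import Mathlib

noncomputable section

namespace MirrorHG

/-- The hypergeometric series
`F(w,x) = ∑_d x^d ∏_{r=1}^{nd} (n w + r) / ∏_{r=1}^{d} ((w + r)^n - w^n)` in `ℚ(w)[[x]]`,
where `w` is the variable of `RatFunc ℚ`. -/
def hyperF (n : ℕ) : PowerSeries (RatFunc ℚ) :=
  PowerSeries.mk fun d =>
    (∏ r ∈ Finset.Icc 1 (n * d), ((n : RatFunc ℚ) * RatFunc.X + (r : RatFunc ℚ))) /
      ∏ r ∈ Finset.Icc 1 d, ((RatFunc.X + (r : RatFunc ℚ)) ^ n - RatFunc.X ^ n)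

/-- `f(w) = O(w ^ k)` as `w → ∞`, for a rational function `f ∈ ℚ(w)`: either `f = 0`, or the
degree of its numerator minus the degree of its denominator is at most `k`. -/
def IsBigOAtInfinity (f : RatFunc ℚ) (k : ℤ) : Prop :=
  f = 0 ∨ f.intDegree ≤ k

/-- `f(w) ∼ ∑_{s ≥ 0} a_s w^{-s}` as `w → ∞`, for a rational function `f ∈ ℚ(w)`. -/
def HasAsymptoticSeries (f : RatFunc ℚ) (a : ℕ → ℚ) : Prop :=
  ∀ N : ℕ, IsBigOAtInfinity
    (f - ∑ s ∈ Finset.range N, RatFunc.C (a s) * (RatFunc.X⁻¹) ^ s) (-(N : ℤ))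

/-- The power series `e^{-μ(x) w}` in `ℚ(w)[[x]]`, for `μ ∈ x ℚ[[x]]`. -/
def expNegMul (mu : PowerSeries ℚ) : PowerSeries (RatFunc ℚ) :=
  (PowerSeries.exp (RatFunc ℚ)).subst
    (-(PowerSeries.C (RatFunc.X : RatFunc ℚ) *
      PowerSeries.map (algebraMap ℚ (RatFunc ℚ)) mu))

/-- The asymptotic expansion `F(w,x) ∼ e^{μ(x) w} ∑_{s ≥ 0} Φ_s(x) w^{-s}` as `w → ∞`, where
`μ ∈ x ℚ[[x]]`: the coefficient of every power of `x` in `e^{-μ(x) w} F(w,x)`, a rational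
function of `w`, is asymptotic to the sum of the corresponding coefficients of `Φ_s(x) w^{-s}`. -/
def HasExpansion (n : ℕ) (mu : PowerSeries ℚ) (Phi : ℕ → PowerSeries ℚ) : Prop :=
  PowerSeries.constantCoeff mu = 0 ∧
    ∀ d : ℕ, HasAsymptoticSeries (PowerSeries.coeff d (expNegMul mu * hyperF n))
      (fun s => PowerSeries.coeff d (Phi s))

/-- The power series `L(x) = (1 - n^n x)^{-1/n}`. -/
def L (n : ℕ) : PowerSeries ℚ :=
  PowerSeries.rescale (-((n : ℚ) ^ n)) (PowerSeries.binomialSeries ℚ (-(1 / (n : ℚ))))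

/-- The operator `D = x d/dx` on `ℚ[[x]]`. -/
def D (f : PowerSeries ℚ) : PowerSeries ℚ :=
  PowerSeries.X * PowerSeries.derivative ℚ f

open Polynomial in
/-- The polynomials `H_{m,j}(X)` (for the fixed integer `n`), defined by `H_{0,j} = δ_{0,j}` and
`H_{m,j} = H_{m-1,j} + (X - 1) (X d/dX + (m - j)/n) H_{m-1,j-1}` for `m ≥ 1`, where
`H_{m-1,j-1} = 0` if `j = 0`. -/
def H (n : ℕ) : ℕ → ℕ → ℚ[X]
  | 0, j => if j = 0 then 1 else 0
  | m + 1, 0 => H n m 0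
  | m + 1, j + 1 => H n m (j + 1) +
      (X - 1) * (X * derivative (H n m j) +
        C ((((m + 1 : ℕ) : ℚ) - ((j + 1 : ℕ) : ℚ)) / (n : ℚ)) * H n m j)

/-- `S_r(n)`, the `r`-th elementary symmetric function of `1, 2, …, n`. -/
def S (r n : ℕ) : ℚ :=
  ((Multiset.range n).map fun i => ((i + 1 : ℕ) : ℚ)).esymm r

/-- The differential operators `𝓛_k`, `0 ≤ k ≤ n`, on `ℚ[[x]]`:
`𝓛_k = ∑_{i=0}^k (binom(n,i) H_{n-i,k-i}(L^n)
  - (L^n - 1) ∑_{r=1}^{k-i} binom(n-r,i) (S_r(n)/n^r) H_{n-i-r,k-i-r}(L^n)) D^i`. -/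
def opL (n k : ℕ) (f : PowerSeries ℚ) : PowerSeries ℚ :=
  ∑ i ∈ Finset.range (k + 1),
    ((n.choose i : PowerSeries ℚ) * Polynomial.aeval (L n ^ n) (H n (n - i) (k - i)) -
      (L n ^ n - 1) * ∑ r ∈ Finset.Icc 1 (k - i),
        PowerSeries.C (((n - r).choose i : ℚ) * (S r n / (n : ℚ) ^ r)) *
          Polynomial.aeval (L n ^ n) (H n (n - i - r) (k - i - r))) * D^[i] f

/-- The left-hand side `∑_{k=1}^n L^{1-k} 𝓛_k(Φ_{s+1-k})` of the `s`-th differential equation,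
with the convention `Φ_r = 0` for `r < 0`. -/
def odeLHS (n : ℕ) (Phi : ℕ → PowerSeries ℚ) (s : ℕ) : PowerSeries ℚ :=
  ∑ k ∈ Finset.Icc 1 n,
    ((L n)⁻¹) ^ (k - 1) * opL n k (if k ≤ s + 1 then Phi (s + 1 - k) else 0)

/-- The sequence solves all the differential equations, with `Φ_s(0) = δ_{0,s}`. -/
def SolvesODE (n : ℕ) (Phi : ℕ → PowerSeries ℚ) : Prop :=
  (∀ s, odeLHS n Phi s = 0) ∧
    ∀ s, PowerSeries.constantCoeff (Phi s) = if s = 0 then 1 else 0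

/-- No coefficient of `Ψ ∈ ℚ(a)[X,Y,Z]` has a pole at `a = t`. -/
def RegularAt (Psi : MvPolynomial (Fin 3) (RatFunc ℚ)) (t : ℚ) : Prop :=
  ∀ e : Fin 3 →₀ ℕ, (Psi.coeff e).denom.eval t ≠ 0

/-- The value `Ψ(t, A, B, C)` of `Ψ = Ψ(a,X,Y,Z) ∈ ℚ(a)[X,Y,Z]` at a rational number `t` (where
its coefficients have no pole) and power series `A, B, C`. -/
def evalAt (Psi : MvPolynomial (Fin 3) (RatFunc ℚ)) (t : ℚ) (A B C : PowerSeries ℚ) :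
    PowerSeries ℚ :=
  ∑ e ∈ Psi.support,
    PowerSeries.C (RatFunc.eval (RingHom.id ℚ) t (Psi.coeff e)) *
      (A ^ e 0 * B ^ e 1 * C ^ e 2)

end MirrorHG

end

namespace MirrorHG

/-- Derivations of a commutative ring, with the canonical `ℤ`-algebra structure. -/
abbrev IntDer (A : Type*) [CommRing A] := Derivation ℤ A A

namespace IntDer

variable {A : Type*} [CommRing A]

/-- The derivation given by an additive map that satisfies the product rule. -/
def ofAddHom (φ : A →+ A) (h : ∀ f g, φ (f * g) = f * φ g + g * φ f) : IntDer A :=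
  Derivation.mk' φ.toIntLinearMap fun f g => by simpa using h f g

variable (δ : IntDer A)

lemma map_mul (f g : A) : δ (f * g) = f * δ g + g * δ f := by
  simp

lemma map_pow (f : A) (n : ℕ) : δ (f ^ n) = n * f ^ (n - 1) * δ f := by
  rw [Derivation.leibniz_pow, nsmul_eq_mul, smul_eq_mul, mul_assoc]

lemma map_one : δ 1 = 0 := Derivation.map_one_eq_zero δ

lemma map_natCast (n : ℕ) : δ n = 0 := Derivation.map_natCast δ n

end IntDer

section PowCoeff

variable {A B : Type*} [CommRing A] [CommRing B]

/-- If `δ p = g p`, the coefficient operator at `p ^ (m - j)` in the `m`-th power of the operator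
`f ↦ δ f + e g f + p f`. -/
def powCoeff (δ : IntDer A) (g e : A) : ℕ → ℕ → A →+ A
  | 0, 0 => AddMonoidHom.id A
  | 0, _ + 1 => 0
  | m + 1, 0 => powCoeff δ g e m 0
  | m + 1, j + 1 => powCoeff δ g e m (j + 1) +
      ((δ : A →ₗ[ℤ] A).toAddMonoidHom + AddMonoidHom.mulLeft ((e + m - j) * g)).comp
        (powCoeff δ g e m j)

variable (δ : IntDer A) (g e : A)

@[simp]
lemma powCoeff_zero (m : ℕ) (f : A) : powCoeff δ g e m 0 f = f := by
  induction m with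
  | zero => rfl
  | succ m ih => exact ih

@[simp]
lemma powCoeff_zero_succ (j : ℕ) (f : A) : powCoeff δ g e 0 (j + 1) f = 0 := rfl

lemma powCoeff_succ_succ (m j : ℕ) (f : A) :
    powCoeff δ g e (m + 1) (j + 1) f = powCoeff δ g e m (j + 1) f +
      (δ (powCoeff δ g e m j f) + (e + m - j) * g * powCoeff δ g e m j f) := rfl

lemma powCoeff_eq_zero_of_lt {m j : ℕ} (h : m < j) (f : A) : powCoeff δ g e m j f = 0 := by
  induction m generalizing j with
  | zero =>
    obtain ⟨j, rfl⟩ := Nat.exists_eq_succ_of_ne_zero h.ne'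
    rfl
  | succ m ih =>
    obtain ⟨j, rfl⟩ := Nat.exists_eq_succ_of_ne_zero (Nat.ne_zero_of_lt h)
    rw [Nat.succ_eq_add_one, powCoeff_succ_succ, ih (by omega), ih (by omega)]
    simp

lemma powCoeff_mul {u c : A} (hu : δ u = c * g * u) (m j : ℕ) (f : A) :
    powCoeff δ g e m j (u * f) = u * powCoeff δ g (e + c) m j f := by
  induction m generalizing j with
  | zero => cases j <;> simp
  | succ m ih =>
    cases j with
    | zero => simp
    | succ j =>
      rw [powCoeff_succ_succ, powCoeff_succ_succ, ih, ih, Derivation.leibniz, hu]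
      simp only [smul_eq_mul]
      ring

lemma map_powCoeff (φ : A →+* B) (δ' : IntDer B) (hφ : ∀ f, φ (δ f) = δ' (φ f))
    (m j : ℕ) (f : A) :
    φ (powCoeff δ g e m j f) = powCoeff δ' (φ g) (φ e) m j (φ f) := by
  induction m generalizing j with
  | zero => cases j <;> simp
  | succ m ih =>
    cases j with
    | zero => simp
    | succ j => simp [powCoeff_succ_succ, ih, hφ]

lemma powCoeff_zero_zero_succ (m j : ℕ) (f : A) :
    powCoeff (0 : IntDer A) 0 e m (j + 1) f = 0 := by
  induction m generalizing j with
  | zero => simp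
  | succ m ih => simp [powCoeff_succ_succ, ih]

lemma powCoeff_one (m : ℕ) (f : A) :
    2 * powCoeff δ g e m 1 f = 2 * m * δ f + m * (2 * e + m - 1) * g * f := by
  induction m with
  | zero => simp
  | succ m ih =>
    rw [powCoeff_succ_succ, powCoeff_zero, mul_add, ih]
    push_cast
    ring

lemma iterate_eq_sum_powCoeff {p : A} (hp : δ p = g * p) {T : A → A}
    (hT : ∀ f, T f = δ f + e * g * f + p * f) (m : ℕ) (f : A) :
    T^[m] f = ∑ j ∈ Finset.range (m + 1), p ^ (m - j) * powCoeff δ g e m j f := by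
  have hpow (k : ℕ) : δ (p ^ k) = k * g * p ^ k := by
    induction k with
    | zero => simp
    | succ k ih =>
      rw [pow_succ, Derivation.leibniz, ih, hp]
      simp only [smul_eq_mul]
      push_cast
      ring
  have hadd : ∀ (s : Finset ℕ) (F : ℕ → A), T (∑ j ∈ s, F j) = ∑ j ∈ s, T (F j) := by
    intro s F
    simp only [hT, map_sum, Finset.mul_sum, Finset.sum_add_distrib]
  induction m with
  | zero => simp
  | succ m ih =>
    rw [Function.iterate_succ_apply', ih, hadd, Finset.sum_range_succ' _ (m + 1)]
    have h1 : ∀ j ∈ Finset.range (m + 1), T (p ^ (m - j) * powCoeff δ g e m j f) =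
        p ^ (m - j) * (δ (powCoeff δ g e m j f) + (e + m - j) * g * powCoeff δ g e m j f) +
          p ^ (m + 1 - j) * powCoeff δ g e m j f := by
      intro j hj
      have hj' : j ≤ m := Nat.lt_succ_iff.mp (Finset.mem_range.mp hj)
      rw [hT, Derivation.leibniz, hpow, Nat.sub_add_comm hj', pow_succ, Nat.cast_sub hj']
      simp only [smul_eq_mul]
      ring
    rw [Finset.sum_congr rfl h1, Finset.sum_add_distrib,
      Finset.sum_range_succ' (fun j => p ^ (m + 1 - j) * powCoeff δ g e m j f)]
    have h2 : ∑ j ∈ Finset.range m, p ^ (m + 1 - (j + 1)) * powCoeff δ g e m (j + 1) f =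
        ∑ j ∈ Finset.range (m + 1), p ^ (m + 1 - (j + 1)) * powCoeff δ g e m (j + 1) f := by
      rw [Finset.sum_range_succ, powCoeff_eq_zero_of_lt δ g e (Nat.lt_succ_self m)]
      simp
    rw [h2, ← add_assoc, ← Finset.sum_add_distrib]
    congr 1
    · refine Finset.sum_congr rfl fun j _ => ?_
      rw [powCoeff_succ_succ, Nat.add_sub_add_right]
      ring

/-- The coefficient operator at `p ^ (n - k)` in `T ^ n - q ∑_{r = 1}^n σ_r T ^ (n - r)`, where
`T f = δ f + e g f + p f` and `δ p = g p`. -/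
def symbolCoeff (q : A) (σ : ℕ → A) (n k : ℕ) : A →+ A :=
  powCoeff δ g e n k - (AddMonoidHom.mulLeft q).comp
    (∑ r ∈ Finset.Icc 1 k, (AddMonoidHom.mulLeft (σ r)).comp (powCoeff δ g e (n - r) (k - r)))

lemma symbolCoeff_apply (q : A) (σ : ℕ → A) (n k : ℕ) (f : A) :
    symbolCoeff δ g e q σ n k f = powCoeff δ g e n k f -
      q * ∑ r ∈ Finset.Icc 1 k, σ r * powCoeff δ g e (n - r) (k - r) f := by
  simp [symbolCoeff, AddMonoidHom.finsetSum_apply]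

@[simp]
lemma symbolCoeff_zero (q : A) (σ : ℕ → A) (n : ℕ) (f : A) :
    symbolCoeff δ g e q σ n 0 f = f := by
  simp [symbolCoeff_apply]

lemma symbolCoeff_eq_zero_of_lt (q : A) (σ : ℕ → A) {n k : ℕ} (hσ : ∀ r, n < r → σ r = 0)
    (h : n < k) (f : A) : symbolCoeff δ g e q σ n k f = 0 := by
  rw [symbolCoeff_apply, powCoeff_eq_zero_of_lt δ g e h, Finset.sum_eq_zero]
  · simp
  · intro r hr
    rcases lt_or_ge n r with h1 | h1
    · rw [hσ r h1, zero_mul]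
    · rw [powCoeff_eq_zero_of_lt δ g e (by omega), mul_zero]

lemma symbolCoeff_mul {u c : A} (hu : δ u = c * g * u) (q : A) (σ : ℕ → A) (n k : ℕ) (f : A) :
    symbolCoeff δ g e q σ n k (u * f) = u * symbolCoeff δ g (e + c) q σ n k f := by
  simp only [symbolCoeff_apply, powCoeff_mul δ g e hu, mul_sub, Finset.mul_sum]
  congr 1
  exact Finset.sum_congr rfl fun r _ => by ring

lemma map_symbolCoeff (φ : A →+* B) (δ' : IntDer B) (hφ : ∀ f, φ (δ f) = δ' (φ f))
    (q : A) (σ : ℕ → A) (n k : ℕ) (f : A) :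
    φ (symbolCoeff δ g e q σ n k f) =
      symbolCoeff δ' (φ g) (φ e) (φ q) (fun r => φ (σ r)) n k (φ f) := by
  simp only [symbolCoeff_apply, map_sub, map_mul, map_sum, map_powCoeff δ g e φ δ' hφ]

lemma symbolCoeff_zero_zero_succ (σ : ℕ → A) (n k : ℕ) (f : A) :
    symbolCoeff (0 : IntDer A) 0 e 0 σ n (k + 1) f = 0 := by
  simp [symbolCoeff_apply, powCoeff_zero_zero_succ]

lemma symbolCoeff_one {n : ℕ} {q : A} {σ : ℕ → A} (hq : q = n * g)
    (hσ : 2 * σ 1 = n + 1) (f : A) :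
    2 * symbolCoeff δ g e q σ n 1 f = 2 * (n * δ f + n * (e - 1) * g * f) := by
  rw [symbolCoeff_apply, mul_sub, powCoeff_one, Finset.Icc_self, Finset.sum_singleton,
    Nat.sub_self, powCoeff_zero]
  have : 2 * (q * (σ 1 * f)) = q * (2 * σ 1) * f := by ring
  rw [this, hσ, hq]
  ring

lemma sum_symbolCoeff {p : A} (hp : δ p = g * p) {T : A → A}
    (hT : ∀ f, T f = δ f + e * g * f + p * f) (q : A) (σ : ℕ → A) (n : ℕ) (f : A) :
    T^[n] f - q * ∑ r ∈ Finset.Icc 1 n, σ r * T^[n - r] f =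
      ∑ k ∈ Finset.range (n + 1), p ^ (n - k) * symbolCoeff δ g e q σ n k f := by
  simp only [symbolCoeff_apply, mul_sub, Finset.sum_sub_distrib]
  rw [← iterate_eq_sum_powCoeff δ g e hp hT]
  congr 1
  have h1 : ∀ r ∈ Finset.Icc 1 n, σ r * T^[n - r] f =
      ∑ k ∈ Finset.Ico r (n + 1), p ^ (n - k) * (σ r * powCoeff δ g e (n - r) (k - r) f) := by
    intro r hr
    rw [Finset.mem_Icc] at hr
    rw [iterate_eq_sum_powCoeff δ g e hp hT, Finset.mul_sum, Finset.sum_Ico_eq_sum_range,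
      show n + 1 - r = n - r + 1 by omega]
    refine Finset.sum_congr rfl fun j _ => ?_
    rw [Nat.add_sub_cancel_left, Nat.sub_sub]
    ring
  rw [Finset.sum_congr rfl h1, Finset.mul_sum]
  simp only [Finset.mul_sum]
  rw [Finset.sum_comm' (t' := Finset.range (n + 1)) (s' := fun k => Finset.Icc 1 k)]
  · exact Finset.sum_congr rfl fun k _ => Finset.sum_congr rfl fun r _ => by ring
  · intro r k
    simp only [Finset.mem_Icc, Finset.mem_Ico, Finset.mem_range]
    omega

end PowCoeff

end MirrorHG

namespace MirrorHG

@[to_additive sum_Icc_one_eq]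
lemma prod_Icc_one_eq {M : Type*} [CommMonoid M] (F : ℕ → M) (n : ℕ) :
    ∏ r ∈ Finset.Icc 1 n, F r = ∏ i ∈ Finset.range n, F (i + 1) := by
  induction n with
  | zero => simp
  | succ n ih => rw [Finset.prod_Icc_succ_top (by omega), ih, Finset.prod_range_succ]

section ElementarySymmetric

@[simp]
lemma S_zero (n : ℕ) : S 0 n = 1 := by
  simp [S, Multiset.esymm]

lemma S_eq_zero_of_lt {r n : ℕ} (h : n < r) : S r n = 0 := by
  rw [S, Multiset.esymm, Multiset.powersetCard_eq_empty]
  · simp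
  · simpa using h

lemma S_succ_succ (r n : ℕ) : S (r + 1) (n + 1) = S (r + 1) n + (n + 1) * S r n := by
  simp only [S, Multiset.esymm, Multiset.range_succ, Multiset.map_cons, Multiset.powersetCard_cons,
    Multiset.map_add, Multiset.sum_add, Multiset.map_map, Function.comp_def, Multiset.prod_cons,
    Multiset.sum_map_mul_left]
  push_cast
  rfl

lemma two_mul_S_one (n : ℕ) : 2 * S 1 n = n * (n + 1) := by
  induction n with
  | zero => simp [S_eq_zero_of_lt]
  | succ n ih =>
    rw [S_succ_succ, mul_add, ih, S_zero]
    push_cast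
    ring

open Polynomial in
lemma sum_S_mul_X_pow (n : ℕ) :
    ∑ r ∈ Finset.range (n + 1), C (S r n) * (X : ℚ[X]) ^ (n - r) =
      ∏ r ∈ Finset.Icc 1 n, (X + C (r : ℚ)) := by
  have h := Multiset.prod_X_add_C_eq_sum_esymm ((Multiset.range n).map fun i => ((i + 1 : ℕ) : ℚ))
  rw [Multiset.map_map, Multiset.card_map, Multiset.card_range] at h
  rw [prod_Icc_one_eq]
  simp only [S]
  rw [← h]
  rfl

open Polynomial in
lemma sum_S_div_mul_X_pow {n : ℕ} (hn : 1 ≤ n) :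
    C ((n : ℚ) ^ n) * ∑ r ∈ Finset.range (n + 1), C (S r n / (n : ℚ) ^ r) * (X : ℚ[X]) ^ (n - r) =
      ∏ r ∈ Finset.Icc 1 n, (C (n : ℚ) * X + C (r : ℚ)) := by
  have hn' : (n : ℚ) ≠ 0 := by positivity
  have h := congrArg (fun P : ℚ[X] => P.comp (C (n : ℚ) * X)) (sum_S_mul_X_pow n)
  simp only [Polynomial.prod_comp, Polynomial.sum_comp, mul_comp, C_comp, pow_comp, X_comp,
    add_comp] at h
  rw [← h, Finset.mul_sum]
  refine Finset.sum_congr rfl fun r hr => ?_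
  have hr' : r ≤ n := Nat.lt_succ_iff.mp (Finset.mem_range.mp hr)
  rw [mul_pow, ← C_pow, ← mul_assoc, ← mul_assoc, ← C_mul, ← C_mul]
  congr 2
  rw [← Nat.sub_add_cancel hr', pow_add, Nat.add_sub_cancel]
  field_simp

end ElementarySymmetric

section LowestCoefficient

open Polynomial

/-- The derivation `f ↦ a f'` of `ℚ[X]`. -/
noncomputable def polyDeriv (a : ℚ[X]) : IntDer ℚ[X] :=
  IntDer.ofAddHom ((AddMonoidHom.mulLeft a).comp (derivative : ℚ[X] →ₗ[ℚ] ℚ[X]).toAddMonoidHom)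
    fun f g => by simp; ring

@[simp]
lemma polyDeriv_apply (a f : ℚ[X]) : polyDeriv a f = a * derivative f := rfl

/-- The operator `f ↦ X f - (X f' + f) / n` on `ℚ[X]`. -/
noncomputable def leadingOp (n : ℕ) : Module.End ℚ ℚ[X] :=
  LinearMap.mulLeft ℚ X - (n : ℚ)⁻¹ • (LinearMap.mulLeft ℚ X ∘ₗ derivative + LinearMap.id)

lemma leadingOp_apply (n : ℕ) (f : ℚ[X]) :
    leadingOp n f = X * f - C (n : ℚ)⁻¹ * (X * derivative f + f) := by
  simp [leadingOp, smul_eq_C_mul, mul_add]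

lemma X_pow_dvd_aeval_leadingOp {n : ℕ} (hn : 1 ≤ n) (R : ℕ) (f : ℚ[X]) :
    X ^ R ∣ aeval (leadingOp n) (∏ r ∈ Finset.Icc 1 R, (C (n : ℚ) * X + C (r : ℚ))) f := by
  have hn' : (n : ℚ) ≠ 0 := by positivity
  induction R with
  | zero => simp
  | succ R ih =>
    obtain ⟨h, hh⟩ := ih
    rw [Finset.prod_Icc_succ_top (by omega), mul_comm, map_mul, Module.End.mul_apply, hh]
    refine ⟨C (n : ℚ) * h - derivative h, ?_⟩
    have hC : C (n : ℚ) * C (n : ℚ)⁻¹ = 1 := by rw [← C_mul, mul_inv_cancel₀ hn', C_1]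
    simp only [map_add, map_mul, aeval_X, aeval_C, LinearMap.add_apply, Module.End.mul_apply,
      Module.algebraMap_end_apply, leadingOp_apply, smul_eq_C_mul, derivative_mul, derivative_X_pow]
    have : (X : ℚ[X]) * (C (R : ℚ) * X ^ (R - 1)) = C (R : ℚ) * X ^ R := by
      rcases R with _ | R
      · simp
      · rw [Nat.add_sub_cancel, pow_succ]; ring
    push_cast
    rw [C_add, C_1]
    linear_combination (-(X * (C (R : ℚ) * X ^ (R - 1)) * h + X * (X ^ R * derivative h)
      + X ^ R * h)) * hC - h * this

lemma symbolCoeff_lowest_eq_zero {n b k : ℕ} (hbk : b < k) (hkn : k ≤ n) :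
    symbolCoeff (0 : IntDer ℚ) (-(n : ℚ)⁻¹) (1 + b) (-1) (fun r => S r n / (n : ℚ) ^ r)
      n k 1 = 0 := by
  have hn : 1 ≤ n := by omega
  have hn' : (n : ℚ) ≠ 0 := by positivity
  set σ : ℕ → ℚ := fun r => S r n / (n : ℚ) ^ r with hσ
  set δ := polyDeriv (C (-(n : ℚ)⁻¹) * X) with hδ_def
  have hδ (f : ℚ[X]) : δ f = C (-(n : ℚ)⁻¹) * X * derivative f := rfl
  clear_value δ
  have key := sum_symbolCoeff δ (C (-(n : ℚ)⁻¹)) 1 (p := X) (by simp [hδ])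
    (T := leadingOp n) (by intro f; rw [leadingOp_apply]; simp [hδ]; ring) (C (-1))
    (fun r => C (σ r)) n (X ^ b)
  have hXb : δ (X ^ b) = C (b : ℚ) * C (-(n : ℚ)⁻¹) * X ^ b := by
    rcases b with _ | b
    · simp [hδ]
    · rw [hδ, derivative_X_pow, Nat.add_sub_cancel, pow_succ]
      ring
  have hsym (j : ℕ) : symbolCoeff δ (C (-(n : ℚ)⁻¹)) 1 (C (-1)) (fun r => C (σ r)) n j (X ^ b) =
      X ^ b * C (symbolCoeff (0 : IntDer ℚ) (-(n : ℚ)⁻¹) (1 + b) (-1) σ n j 1) := by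
    rw [map_symbolCoeff (0 : IntDer ℚ) _ _ C δ (by simp [hδ])]
    rw [← mul_one (X ^ b), symbolCoeff_mul δ _ _ hXb]
    simp
  have hdvd : X ^ n ∣ (leadingOp n)^[n] (X ^ b) -
      C (-1) * ∑ r ∈ Finset.Icc 1 n, C (σ r) * (leadingOp n)^[n - r] (X ^ b) := by
    have h1 := X_pow_dvd_aeval_leadingOp hn n (X ^ b)
    rw [← sum_S_div_mul_X_pow hn, map_mul, aeval_C, Module.End.mul_apply,
      Module.algebraMap_end_apply, smul_eq_C_mul] at h1
    have h2 := (IsUnit.dvd_mul_left (isUnit_C.mpr (pow_ne_zero n hn').isUnit)).mp h1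
    convert h2 using 1
    rw [Finset.sum_range_succ', map_add, map_sum, LinearMap.add_apply, LinearMap.sum_apply]
    simp only [map_mul, aeval_C, aeval_X_pow, Module.End.mul_apply, Module.algebraMap_end_apply,
      smul_eq_C_mul, Module.End.pow_apply]
    rw [sum_Icc_one_eq]
    simp
    ring
  rw [key] at hdvd
  have hc := (X_pow_dvd_iff.mp hdvd) (n - k + b) (by omega)
  rw [finsetSum_coeff, Finset.sum_eq_single k] at hc
  · rw [hsym, ← mul_assoc, ← pow_add, coeff_mul_C, coeff_X_pow_self, one_mul] at hc
    exact hc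
  · intro j hj hjk
    have := Finset.mem_range.mp hj
    rw [hsym, ← mul_assoc, ← pow_add, coeff_mul_C, coeff_X_pow, if_neg (by omega), zero_mul]
  · intro h
    exact absurd (Finset.mem_range.mpr (by omega)) h

end LowestCoefficient

end MirrorHG

namespace MirrorHG

section Binomial

variable {A : Type*} [CommRing A] (δ : IntDer A) (g e : A)

/-- The coefficients of the expansion of `powCoeff δ g e m j f` in the binomial coefficients
`m.choose t`. -/
def binomCoeff (f : A) : ℕ → ℕ → A
  | 0, 0 => f
  | 0, _ + 1 => 0
  | _ + 1, 0 => 0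
  | j + 1, t + 1 => δ (binomCoeff f j t) +
      g * ((e + t - j) * binomCoeff f j t + t * binomCoeff f j (t - 1))

lemma binomCoeff_eq_zero (f : A) {j t : ℕ} (h : 2 * j < t) : binomCoeff δ g e f j t = 0 := by
  induction j generalizing t with
  | zero =>
    obtain ⟨t, rfl⟩ := Nat.exists_eq_succ_of_ne_zero (Nat.ne_zero_of_lt h)
    rfl
  | succ j ih =>
    obtain ⟨t, rfl⟩ := Nat.exists_eq_succ_of_ne_zero (Nat.ne_zero_of_lt h)
    rw [Nat.succ_eq_add_one, binomCoeff, ih (by omega), ih (by omega)]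
    simp

lemma powCoeff_eq_sum_choose (f : A) (m j M : ℕ) (hM : 2 * j < M) :
    powCoeff δ g e m j f = ∑ t ∈ Finset.range M, (m.choose t : A) * binomCoeff δ g e f j t := by
  have hM1 (j M : ℕ) (hM : 2 * j < M) (F : ℕ → A) :
      ∑ t ∈ Finset.range M, F t * binomCoeff δ g e f j t =
        ∑ t ∈ Finset.range (2 * j + 1), F t * binomCoeff δ g e f j t := by
    symm
    refine Finset.sum_subset (by intro x; simp; omega) fun t _ ht => ?_
    rw [binomCoeff_eq_zero δ g e f (by simpa using ht), mul_zero]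
  induction j generalizing m M with
  | zero => rw [hM1 _ _ hM]; simp [binomCoeff]
  | succ j ihj =>
    induction m with
    | zero =>
      rw [powCoeff_zero_succ, Finset.sum_eq_zero]
      rintro (_ | t) _ <;> simp [binomCoeff]
    | succ m ihm =>
      rw [powCoeff_succ_succ, ihm, hM1 _ _ hM, hM1 _ _ hM]
      have hstep : δ (powCoeff δ g e m j f) + (e + m - j) * g * powCoeff δ g e m j f =
          ∑ t ∈ Finset.range (2 * j + 2), (m.choose t : A) * binomCoeff δ g e f (j + 1) (t + 1) := by
        have hδ : δ (powCoeff δ g e m j f) =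
            ∑ t ∈ Finset.range (2 * j + 2), (m.choose t : A) * δ (binomCoeff δ g e f j t) := by
          rw [ihj m (2 * j + 2) (by omega), map_sum]
          refine Finset.sum_congr rfl fun t _ => ?_
          simp
        have h1 : (m : A) * powCoeff δ g e m j f = ∑ t ∈ Finset.range (2 * j + 2),
            (m.choose t : A) * (t * (binomCoeff δ g e f j t + binomCoeff δ g e f j (t - 1))) := by
          have h2 : ∑ t ∈ Finset.range (2 * j + 2),
              (m.choose t : A) * (t * binomCoeff δ g e f j (t - 1)) =
              ∑ t ∈ Finset.range (2 * j + 1), ((m : A) - t) * m.choose t * binomCoeff δ g e f j t := by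
            rw [Finset.sum_range_succ']
            simp only [Nat.cast_zero, zero_mul, mul_zero, add_zero, Nat.add_sub_cancel]
            refine Finset.sum_congr rfl fun t _ => ?_
            have h3 : ((m.choose (t + 1) : ℕ) : A) * ((t + 1 : ℕ) : A) =
                (m.choose t : A) * ((m : A) - t) := by
              rcases le_or_gt t m with htm | htm
              · rw [← Nat.cast_sub htm]
                exact_mod_cast congrArg (Nat.cast : ℕ → A) (Nat.choose_succ_right_eq m t)
              · rw [Nat.choose_eq_zero_of_lt htm, Nat.choose_eq_zero_of_lt (by omega)]
                simp
            rw [← mul_assoc, h3]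
            ring
          simp only [mul_add, Finset.sum_add_distrib]
          rw [h2, ihj m (2 * j + 1) (by omega), Finset.mul_sum, Finset.sum_range_succ _ (2 * j + 1),
            binomCoeff_eq_zero δ g e f (Nat.lt_succ_self (2 * j)), mul_zero, mul_zero, add_zero,
            ← Finset.sum_add_distrib]
          exact Finset.sum_congr rfl fun t _ => by ring
        have h4 : (e + m - j) * g * powCoeff δ g e m j f =
            (e - j) * g * powCoeff δ g e m j f + g * (m * powCoeff δ g e m j f) := by ring
        rw [h4, h1, hδ, ihj m (2 * j + 2) (by omega), Finset.mul_sum, Finset.mul_sum,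
          ← Finset.sum_add_distrib, ← Finset.sum_add_distrib]
        refine Finset.sum_congr rfl fun t _ => ?_
        rw [binomCoeff]
        ring
      rw [hstep, show 2 * (j + 1) + 1 = 2 * j + 2 + 1 by ring, Finset.sum_range_succ',
        Finset.sum_range_succ' _ (2 * j + 2), add_right_comm, ← Finset.sum_add_distrib]
      congr 1
      · refine Finset.sum_congr rfl fun t _ => ?_
        rw [Nat.choose_succ_succ]
        push_cast
        ring
      · simp

end Binomial

section Uniform

open Polynomial

/-- The functions of `n ≥ 1` that are given by a rational function of `n` without poles at the
positive integers. -/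
def regularFun : Subring (ℕ → ℚ) where
  carrier := {c | ∃ p q : ℚ[X], ∀ n : ℕ, 1 ≤ n → q.eval (n : ℚ) ≠ 0 ∧
    c n = p.eval (n : ℚ) / q.eval (n : ℚ)}
  mul_mem' := by
    rintro a b ⟨p, q, h⟩ ⟨p', q', h'⟩
    refine ⟨p * p', q * q', fun n hn => ?_⟩
    obtain ⟨h1, h2⟩ := h n hn
    obtain ⟨h3, h4⟩ := h' n hn
    rw [Pi.mul_apply, h2, h4, eval_mul, eval_mul]
    exact ⟨mul_ne_zero h1 h3, by field_simp⟩
  one_mem' := ⟨1, 1, fun n _ => by simp⟩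
  add_mem' := by
    rintro a b ⟨p, q, h⟩ ⟨p', q', h'⟩
    refine ⟨p * q' + q * p', q * q', fun n hn => ?_⟩
    obtain ⟨h1, h2⟩ := h n hn
    obtain ⟨h3, h4⟩ := h' n hn
    rw [Pi.add_apply, h2, h4, eval_mul, eval_add, eval_mul, eval_mul]
    exact ⟨mul_ne_zero h1 h3, by field_simp⟩
  zero_mem' := ⟨0, 1, fun n _ => by simp⟩
  neg_mem' := by
    rintro a ⟨p, q, h⟩
    refine ⟨-p, q, fun n hn => ⟨(h n hn).1, ?_⟩⟩
    rw [Pi.neg_apply, (h n hn).2, eval_neg, neg_div]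

lemma eval_mem_regularFun (p : ℚ[X]) : (fun n : ℕ => p.eval (n : ℚ)) ∈ regularFun :=
  ⟨p, 1, fun n _ => by simp⟩

lemma const_mem_regularFun (a : ℚ) : (fun _ : ℕ => a) ∈ regularFun := by
  simpa using eval_mem_regularFun (C a)

lemma inv_natCast_mem_regularFun : (fun n : ℕ => (n : ℚ)⁻¹) ∈ regularFun :=
  ⟨1, X, fun n hn => by simp; omega⟩

lemma regularFun_sum {ι : Type*} (s : Finset ι) (c : ι → ℕ → ℚ) (h : ∀ i ∈ s, c i ∈ regularFun) :
    (fun n => ∑ i ∈ s, c i n) ∈ regularFun := by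
  have := Subring.sum_mem regularFun h
  convert this using 1
  ext n
  simp

/-- Division by `m n - s` preserves regularity if the numerator vanishes when `m n = s`. -/
lemma exists_regularFun_div {c : ℕ → ℚ} (hc : c ∈ regularFun) {m s : ℕ} (hs : 1 ≤ s)
    (h : ∀ n, 1 ≤ n → n * m = s → c n = 0) :
    ∃ c' ∈ regularFun, ∀ n : ℕ, 1 ≤ n → ((n : ℚ) * m - s) * c' n = c n := by
  obtain ⟨p, q, hpq⟩ := hc
  by_cases hms : ∃ a : ℕ, 1 ≤ a ∧ a * m = s
  · obtain ⟨a, ha, rfl⟩ := hms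
    have hm : (m : ℚ) ≠ 0 := by
      rintro h0
      rw [Nat.cast_eq_zero] at h0
      simp [h0] at hs
    have hpa : p.IsRoot (a : ℚ) := by
      have := h a ha rfl
      rw [(hpq a ha).2, div_eq_zero_iff] at this
      exact this.resolve_right (hpq a ha).1
    obtain ⟨p', rfl⟩ := dvd_iff_isRoot.mpr hpa
    refine ⟨fun n => (p'.eval (n : ℚ)) / ((C (m : ℚ) * q).eval (n : ℚ)),
      ⟨p', C (m : ℚ) * q, fun n hn => ⟨?_, rfl⟩⟩, fun n hn => ?_⟩
    · rw [eval_mul, eval_C]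
      exact mul_ne_zero hm (hpq n hn).1
    · have := (hpq n hn).1
      rw [(hpq n hn).2]
      simp only [eval_mul, eval_sub, eval_X, eval_C]
      push_cast
      field_simp
  · have hne : ∀ n : ℕ, 1 ≤ n → (n : ℚ) * m - s ≠ 0 := by
      intro n hn h0
      exact hms ⟨n, hn, by exact_mod_cast sub_eq_zero.mp h0⟩
    refine ⟨fun n => p.eval (n : ℚ) / ((X * C (m : ℚ) - C (s : ℚ)) * q).eval (n : ℚ),
      ⟨p, (X * C (m : ℚ) - C (s : ℚ)) * q, fun n hn => ⟨?_, rfl⟩⟩, fun n hn => ?_⟩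
    · simpa using ⟨hne n hn, (hpq n hn).1⟩
    · have h1 := (hpq n hn).1
      have h2 := hne n hn
      rw [(hpq n hn).2]
      simp only [eval_mul, eval_sub, eval_X, eval_C]
      field_simp

lemma exists_polynomial_forward_diff (p : ℚ[X]) :
    ∃ q : ℚ[X], ∀ n : ℕ, q.eval (n : ℚ) = ∑ i ∈ Finset.range n, p.eval (i : ℚ) := by
  induction p using Polynomial.induction_on' with
  | add p q hp hq =>
    obtain ⟨p', hp'⟩ := hp
    obtain ⟨q', hq'⟩ := hq
    exact ⟨p' + q', fun n => by simp [hp', hq', Finset.sum_add_distrib]⟩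
  | monomial k a =>
    refine ⟨C (a / (k + 1)) * (Polynomial.bernoulli (k + 1) - C (_root_.bernoulli (k + 1))),
      fun n => ?_⟩
    have := Polynomial.sum_range_pow_eq_bernoulli_sub n k
    have hk : (k : ℚ) + 1 ≠ 0 := by positivity
    simp only [eval_mul, eval_C, eval_sub, eval_monomial]
    rw [← Finset.mul_sum, Nat.succ_eq_add_one] at *
    rw [← this]
    field_simp

lemma exists_polynomial_S (r : ℕ) : ∃ p : ℚ[X], ∀ n : ℕ, p.eval (n : ℚ) = S r n := by
  induction r with
  | zero => exact ⟨1, by simp⟩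
  | succ r ih =>
    obtain ⟨p, hp⟩ := ih
    obtain ⟨q, hq⟩ := exists_polynomial_forward_diff ((X + 1) * p)
    refine ⟨q, fun n => ?_⟩
    rw [hq]
    induction n with
    | zero => simp [S_eq_zero_of_lt]
    | succ n ih => rw [Finset.sum_range_succ, ih, S_succ_succ]; simp [hp]

lemma exists_polynomial_choose (t : ℕ) : ∃ p : ℚ[X], ∀ n : ℕ, p.eval (n : ℚ) = n.choose t := by
  refine ⟨C ((t.factorial : ℚ)⁻¹) * descPochhammer ℚ t, fun n => ?_⟩
  rw [eval_mul, eval_C, descPochhammer_eval_eq_descFactorial, Nat.descFactorial_eq_factorial_mul_choose]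
  have : (t.factorial : ℚ) ≠ 0 := by positivity
  push_cast
  field_simp

lemma choose_mem_regularFun (t : ℕ) : (fun n : ℕ => (n.choose t : ℚ)) ∈ regularFun := by
  obtain ⟨p, hp⟩ := exists_polynomial_choose t
  simpa [hp] using eval_mem_regularFun p

lemma S_mul_choose_mem_regularFun (r t : ℕ) :
    (fun n : ℕ => S r n / (n : ℚ) ^ r * ((n - r).choose t : ℚ)) ∈ regularFun := by
  obtain ⟨p, hp⟩ := exists_polynomial_S r
  obtain ⟨q, hq⟩ := exists_polynomial_choose t
  have h1 := mul_mem (mul_mem (eval_mem_regularFun p) (pow_mem inv_natCast_mem_regularFun r))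
    (eval_mem_regularFun (q.comp (X - C (r : ℚ))))
  convert h1 using 1
  ext n
  simp only [Pi.mul_apply, Pi.pow_apply, hp]
  rcases lt_or_ge n r with h | h
  · simp [S_eq_zero_of_lt h]
  · rw [eval_comp, eval_sub, eval_X, eval_C, ← Nat.cast_sub h, hq, div_eq_mul_inv, inv_pow]

lemma coeff_eq_neg_sum_X_sub_one_mul (G : ℚ[X]) (m : ℕ) :
    G.coeff m = -∑ i ∈ Finset.range (m + 1), ((X - 1) * G).coeff i := by
  induction m with
  | zero => simp [sub_mul]
  | succ m ih =>
    rw [Finset.sum_range_succ, neg_add, ← ih, sub_mul, coeff_sub, coeff_X_mul, one_mul]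
    ring

/-- The families of polynomials, indexed by `n ≥ 1`, of bounded degree and with coefficients in
`regularFun`. -/
def UniformFamily (G : ℕ → ℚ[X]) : Prop :=
  (∃ M, ∀ n m, M ≤ m → (G n).coeff m = 0) ∧ ∀ m, (fun n => (G n).coeff m) ∈ regularFun

namespace UniformFamily

variable {G G' : ℕ → ℚ[X]}

lemma add (h : UniformFamily G) (h' : UniformFamily G') : UniformFamily fun n => G n + G' n := by
  obtain ⟨M, hM⟩ := h.1
  obtain ⟨M', hM'⟩ := h'.1
  refine ⟨⟨max M M', fun n m hm => ?_⟩, fun m => ?_⟩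
  · rw [coeff_add, hM n m (le_trans (le_max_left _ _) hm), hM' n m (le_trans (le_max_right _ _) hm),
      add_zero]
  · simp only [coeff_add]
    exact add_mem (h.2 m) (h'.2 m)

lemma mul (h : UniformFamily G) (h' : UniformFamily G') : UniformFamily fun n => G n * G' n := by
  obtain ⟨M, hM⟩ := h.1
  obtain ⟨M', hM'⟩ := h'.1
  refine ⟨⟨M + M', fun n m hm => ?_⟩, fun m => ?_⟩
  · rw [coeff_mul]
    refine Finset.sum_eq_zero fun x hx => ?_
    rw [Finset.HasAntidiagonal.mem_antidiagonal] at hx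
    rcases le_or_gt M x.1 with h1 | h1
    · rw [hM n _ h1, zero_mul]
    · rw [hM' n _ (by omega), mul_zero]
  · simp only [coeff_mul]
    exact regularFun_sum _ _ fun x _ => mul_mem (h.2 x.1) (h'.2 x.2)

lemma C {c : ℕ → ℚ} (hc : c ∈ regularFun) : UniformFamily fun n => C (c n) := by
  refine ⟨⟨1, fun n m hm => by rw [coeff_C_of_ne_zero (by omega)]⟩, fun m => ?_⟩
  rcases m with _ | m
  · simpa using hc
  · simpa using const_mem_regularFun 0

lemma const (P : ℚ[X]) : UniformFamily fun _ => P :=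
  ⟨⟨P.natDegree + 1, fun _ _ hm => coeff_eq_zero_of_natDegree_lt hm⟩,
    fun _ => const_mem_regularFun _⟩

lemma neg (h : UniformFamily G) : UniformFamily fun n => -G n := by
  simpa using (const (-1)).mul h

lemma sub (h : UniformFamily G) (h' : UniformFamily G') : UniformFamily fun n => G n - G' n := by
  simpa [sub_eq_add_neg] using h.add h'.neg

lemma derivative (h : UniformFamily G) : UniformFamily fun n => derivative (G n) := by
  obtain ⟨M, hM⟩ := h.1
  refine ⟨⟨M, fun n m hm => ?_⟩, fun m => ?_⟩
  · rw [coeff_derivative, hM n _ (by omega), zero_mul]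
  · simp only [coeff_derivative]
    exact mul_mem (h.2 (m + 1)) (const_mem_regularFun _)

lemma sum {ι : Type*} (s : Finset ι) {F : ι → ℕ → ℚ[X]} (h : ∀ i ∈ s, UniformFamily (F i)) :
    UniformFamily fun n => ∑ i ∈ s, F i n := by
  classical
  induction s using Finset.induction_on with
  | empty => simpa using const 0
  | insert a s ha ih =>
    simp only [Finset.sum_insert ha]
    exact (h a (Finset.mem_insert_self a s)).add
      (ih fun i hi => h i (Finset.mem_insert_of_mem hi))

/-- Division by `X - 1`. -/
lemma of_X_sub_one_mul (h : UniformFamily fun n => (X - 1) * G n) : UniformFamily G := by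
  obtain ⟨M, hM⟩ := h.1
  refine ⟨⟨M, fun n m hm => ?_⟩, fun m => ?_⟩
  · by_contra hne
    have hdeg : ((X - 1) * G n).coeff ((G n).natDegree + 1) ≠ 0 := by
      rw [sub_mul, coeff_sub, coeff_X_mul, one_mul,
        coeff_eq_zero_of_natDegree_lt (Nat.lt_succ_self _), sub_zero]
      intro h0
      rw [coeff_natDegree, leadingCoeff_eq_zero] at h0
      simp [h0] at hne
    exact hdeg (hM n _ (by have := le_natDegree_of_ne_zero hne; omega))
  · have : (fun n => (G n).coeff m) = fun n =>
        -∑ i ∈ Finset.range (m + 1), ((X - 1) * G n).coeff i :=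
      funext fun n => coeff_eq_neg_sum_X_sub_one_mul (G n) m
    rw [this]
    exact neg_mem (regularFun_sum _ _ fun i _ => h.2 i)

end UniformFamily

end Uniform

end MirrorHG

namespace MirrorHG

open Polynomial

/-- The operator `G ↦ X⁻ᵉ Λ_k (Xᵉ G)` on `ℚ[X]`, where `X` stands for `L ^ n`, `Xᵉ` for `L ^ (1 - i)`
and `Λ_k` for `opL n k`. -/
noncomputable def redOp (n i k : ℕ) : ℚ[X] →+ ℚ[X] :=
  symbolCoeff (polyDeriv (X * (X - 1))) (C (n : ℚ)⁻¹ * (X - 1)) (1 - (i : ℚ[X])) (X - 1)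
    (fun r => C (S r n / (n : ℚ) ^ r)) n k

lemma X_sub_one_dvd_redOp (n i k : ℕ) (f : ℚ[X]) : X - 1 ∣ redOp n i (k + 1) f := by
  rw [← C_1, dvd_iff_isRoot, IsRoot.def, ← coe_evalRingHom, redOp,
    map_symbolCoeff _ _ _ _ (0 : IntDer ℚ) (by simp)]
  simpa using symbolCoeff_zero_zero_succ _ _ n k _

lemma redOp_one {n : ℕ} (hn : 1 ≤ n) (i : ℕ) (f : ℚ[X]) :
    redOp n i 1 f = (X - 1) * ((n : ℚ[X]) * (X * derivative f) - (i : ℚ[X]) * f) := by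
  have hn' : (n : ℚ) ≠ 0 := by positivity
  have hC : (n : ℚ[X]) * C (n : ℚ)⁻¹ = 1 := by
    rw [← C_eq_natCast, ← C_mul, mul_inv_cancel₀ hn', C_1]
  have hσ : 2 * C (S 1 n / (n : ℚ) ^ 1) = (n : ℚ[X]) + 1 := by
    rw [show (2 : ℚ[X]) = C 2 from rfl, ← C_mul, ← mul_div_assoc, two_mul_S_one, pow_one,
      mul_div_cancel_left₀ _ hn', C_add, C_1, C_eq_natCast]
  have h := symbolCoeff_one (polyDeriv (X * (X - 1))) (C (n : ℚ)⁻¹ * (X - 1)) (1 - (i : ℚ[X]))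
    (n := n) (q := X - 1) (σ := fun r => C (S r n / (n : ℚ) ^ r))
    (by linear_combination (1 - X) * hC) hσ f
  have h2 := mul_left_cancel₀ (two_ne_zero) h
  rw [redOp, h2, polyDeriv_apply]
  linear_combination (-(i : ℚ[X]) * (X - 1) * f) * hC

lemma redOp_eq_zero_of_lt {n i k : ℕ} (h : n < k) (f : ℚ[X]) : redOp n i k f = 0 :=
  symbolCoeff_eq_zero_of_lt _ _ _ _ _ (fun r hr => by simp [S_eq_zero_of_lt hr]) h f

lemma coeff_redOp_eq_zero {n : ℕ} (hn : 1 ≤ n) {i k : ℕ} {f : ℚ[X]}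
    (hf : ∀ m, n * m < i → f.coeff m = 0) {m : ℕ} (hm : n * m < k + i) :
    (redOp n i k f).coeff m = 0 := by
  have hn' : (n : ℚ) ≠ 0 := by positivity
  rcases lt_or_ge n k with hk | hk
  · rw [redOp_eq_zero_of_lt hk, coeff_zero]
  conv_lhs => rw [f.as_sum_support_C_mul_X_pow]
  rw [map_sum, finsetSum_coeff]
  refine Finset.sum_eq_zero fun l hl => ?_
  have hil : i ≤ n * l := by
    by_contra! h
    exact mem_support_iff.mp hl (hf l h)
  obtain ⟨b, hb⟩ := Nat.exists_eq_add_of_le hil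
  have hXl : polyDeriv (X * (X - 1)) (X ^ l) =
      ((n * l : ℕ) : ℚ[X]) * (C (n : ℚ)⁻¹ * (X - 1)) * X ^ l := by
    have hC : (n : ℚ[X]) * C (n : ℚ)⁻¹ = 1 := by
      rw [← C_eq_natCast, ← C_mul, mul_inv_cancel₀ hn', C_1]
    rcases l with _ | l
    · simp
    · rw [polyDeriv_apply, derivative_X_pow, Nat.add_sub_cancel, pow_succ, Nat.cast_mul,
        C_eq_natCast]
      linear_combination (-((l + 1 : ℕ) : ℚ[X]) * (X - 1) * X ^ l * X) * hC
  rw [mul_comm, redOp, symbolCoeff_mul _ _ _ hXl, coeff_X_pow_mul']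
  split_ifs with hlm
  · have hle : n * l ≤ n * m := Nat.mul_le_mul_left n hlm
    obtain rfl : l = m := by
      rcases hlm.lt_or_eq with h | h
      · have : n * (l + 1) ≤ n * m := Nat.mul_le_mul_left n h
        rw [mul_add, mul_one] at this
        omega
      · exact h
    rw [Nat.sub_self, coeff_zero_eq_eval_zero, ← coe_evalRingHom,
      map_symbolCoeff _ _ _ _ (0 : IntDer ℚ) (by simp)]
    have h0 := symbolCoeff_lowest_eq_zero (n := n) (b := b) (k := k) (by omega) hk
    have h1 := symbolCoeff_mul (0 : IntDer ℚ) (-(n : ℚ)⁻¹) (1 + b) (u := f.coeff l) (c := 0)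
      (by simp) (-1) (fun r => S r n / (n : ℚ) ^ r) n k 1
    rw [add_zero, h0, mul_zero, mul_one] at h1
    refine Eq.trans ?_ h1
    have he : (1 : ℚ) - i + (n * l : ℕ) = 1 + b := by rw [hb]; push_cast; ring
    simp only [coe_evalRingHom, eval_add, eval_sub, eval_one, eval_natCast, eval_mul, eval_C,
      eval_X, he]
    congr 2 <;> ring
  · rfl

lemma UniformFamily.binomCoeff {G : ℕ → ℚ[X]} (hG : UniformFamily G) (i j t : ℕ) :
    UniformFamily fun n => binomCoeff (polyDeriv (X * (X - 1))) (Polynomial.C (n : ℚ)⁻¹ * (X - 1))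
      (1 - (i : ℚ[X])) (G n) j t := by
  induction j generalizing t with
  | zero =>
    rcases t with _ | t
    · exact hG
    · exact const 0
  | succ j ih =>
    rcases t with _ | t
    · exact const 0
    · exact ((const _).mul (ih t).derivative).add (((C inv_natCast_mem_regularFun).mul
        (const _)).mul (((const _).mul (ih t)).add ((const _).mul (ih (t - 1)))))

lemma UniformFamily.redOp {G : ℕ → ℚ[X]} (hG : UniformFamily G) (i k : ℕ) :
    UniformFamily fun n => redOp n i k (G n) := by
  simp only [MirrorHG.redOp, symbolCoeff_apply]
  refine UniformFamily.sub ?_ ((const _).mul (UniformFamily.sum _ fun r _ => ?_))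
  · simp only [powCoeff_eq_sum_choose _ _ _ _ _ _ _ (Nat.lt_succ_self (2 * k))]
    refine UniformFamily.sum _ fun t _ => UniformFamily.mul ?_ (hG.binomCoeff i k t)
    simpa using C (choose_mem_regularFun t)
  · simp only [powCoeff_eq_sum_choose _ _ _ _ _ _ _ (Nat.lt_succ_self (2 * (k - r))),
      Finset.mul_sum, ← mul_assoc]
    refine UniformFamily.sum _ fun t _ => UniformFamily.mul ?_ (hG.binomCoeff i (k - r) t)
    simpa using C (S_mul_choose_mem_regularFun r t)

lemma exists_seq_of_forall {α : Type*} [Nonempty α] (R : ℕ → (ℕ → α) → α → Prop)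
    (hR : ∀ s g g' y, (∀ i < s, g i = g' i) → R s g y → R s g' y)
    (h : ∀ s g, (∀ i < s, R i g (g i)) → ∃ y, R s g y) : ∃ f : ℕ → α, ∀ s, R s f (f s) := by
  classical
  let pick (s : ℕ) (g : ℕ → α) : α := Classical.epsilon fun y => R s g y
  let F : ℕ → ℕ → α := fun s => Nat.rec (fun _ => Classical.arbitrary α)
    (fun s g => Function.update g s (pick s g)) s
  have hF (s : ℕ) : F (s + 1) = Function.update (F s) s (pick s (F s)) := rfl
  have hstable (s t : ℕ) (hst : s < t) : F t s = F (s + 1) s := by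
    induction t, hst using Nat.le_induction with
    | base => rfl
    | succ t ht ih =>
      rw [hF, Function.update_of_ne (by simp only [Nat.succ_eq_add_one] at ht; omega), ih]
  have hpick (s : ℕ) : F (s + 1) s = pick s (F s) := by rw [hF, Function.update_self]
  have hagree (s i : ℕ) (hi : i < s) : F s i = F (i + 1) i := hstable i s hi
  refine ⟨fun s => F (s + 1) s, fun s => ?_⟩
  induction s using Nat.strong_induction_on with
  | _ s ih =>
    have h1 : ∃ y, R s (F s) y := by
      refine h s (F s) fun i hi => ?_
      have h2 := ih i hi
      rw [hagree s i hi]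
      exact hR i _ _ _ (fun l hl => (hagree s l (hl.trans hi)).symm) h2
    have h3 : R s (F s) (pick s (F s)) := Classical.epsilon_spec h1
    beta_reduce
    rw [hpick]
    exact hR s _ _ _ (fun i hi => hagree s i hi) h3

/-- The solution `Φ_s = L ^ (1 - s) G_s(L ^ n)` of the differential equations, normalised by its
exponents instead of its initial values. -/
lemma exists_normalized_solution : ∃ G : ℕ → ℕ → ℚ[X], (∀ n, G 0 n = 1) ∧
    ∀ s, UniformFamily (G s) ∧ ∀ n, 1 ≤ n → (∀ m, n * m < s → (G s n).coeff m = 0) ∧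
      ∑ i ∈ Finset.range (s + 1), redOp n i (s + 1 - i) (G i n) = 0 := by
  let R : ℕ → (ℕ → ℕ → ℚ[X]) → (ℕ → ℚ[X]) → Prop := fun s g y =>
    (s = 0 → ∀ n, y n = 1) ∧ UniformFamily y ∧
      ∀ n, 1 ≤ n → (∀ m, n * m < s → (y n).coeff m = 0) ∧
        ∑ i ∈ Finset.range s, redOp n i (s + 1 - i) (g i n) + redOp n s 1 (y n) = 0
  have hmain : ∃ G : ℕ → ℕ → ℚ[X], ∀ s, R s G (G s) := by
    refine exists_seq_of_forall R ?_ ?_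
    · rintro s g g' y hg ⟨h1, h2, h3⟩
      refine ⟨h1, h2, fun n hn => ⟨(h3 n hn).1, ?_⟩⟩
      rw [← (h3 n hn).2]
      congr 1
      exact Finset.sum_congr rfl fun i hi => by rw [hg i (Finset.mem_range.mp hi)]
    · intro s g hg
      rcases Nat.eq_zero_or_pos s with rfl | hs
      · exact ⟨fun _ => 1, fun _ _ => rfl, UniformFamily.const 1, fun n hn =>
          ⟨by simp, by simp [redOp_one hn]⟩⟩
      · have hdvd (n : ℕ) : X - 1 ∣ -∑ i ∈ Finset.range s, redOp n i (s + 1 - i) (g i n) := by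
          refine (Finset.dvd_sum fun i hi => ?_).neg_right
          rw [Nat.sub_add_comm (Finset.mem_range.mp hi).le]
          exact X_sub_one_dvd_redOp n i _ _
        choose E hE using hdvd
        have hEu : UniformFamily E := by
          refine UniformFamily.of_X_sub_one_mul ?_
          simp only [← hE]
          exact (UniformFamily.sum _ fun i hi =>
            ((hg i (Finset.mem_range.mp hi)).2.1).redOp i _).neg
        have hE0 (n : ℕ) (hn : 1 ≤ n) (m : ℕ) (hm : n * m ≤ s) : (E n).coeff m = 0 := by
          rw [coeff_eq_neg_sum_X_sub_one_mul, ← hE, Finset.sum_eq_zero, neg_zero]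
          intro l hl
          rw [coeff_neg, finsetSum_coeff, Finset.sum_eq_zero, neg_zero]
          intro i hi
          have hi' := Finset.mem_range.mp hi
          have hlm : n * l ≤ n * m :=
            Nat.mul_le_mul_left n (Nat.lt_succ_iff.mp (Finset.mem_range.mp hl))
          exact coeff_redOp_eq_zero hn ((hg i hi').2.2 n hn).1 (by omega)
        have hdiv (m : ℕ) := exists_regularFun_div (hEu.2 m) (m := m) hs
          (fun n hn hnm => hE0 n hn m hnm.le)
        choose c hc hcE using hdiv
        obtain ⟨M, hM⟩ := hEu.1
        have hcoeff (n m : ℕ) : (∑ l ∈ Finset.range M, C (c l n) * X ^ l).coeff m =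
            if m < M then c m n else 0 := by
          rw [finsetSum_coeff]
          simp only [coeff_C_mul_X_pow]
          rw [Finset.sum_ite_eq]
          simp
        have hcoeffE (n : ℕ) (hn : 1 ≤ n) (m : ℕ) : ((n : ℚ) * m - s) *
            (∑ l ∈ Finset.range M, C (c l n) * X ^ l).coeff m = (E n).coeff m := by
          rw [hcoeff]
          split_ifs with h
          · exact hcE m n hn
          · rw [mul_zero, hM n m (not_lt.mp h)]
        refine ⟨fun n => ∑ l ∈ Finset.range M, C (c l n) * X ^ l, fun h => by omega,
          UniformFamily.sum _ fun l _ => (UniformFamily.C (hc l)).mul (UniformFamily.const _),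
          fun n hn => ⟨fun m hm => ?_, ?_⟩⟩
        · have h1 := hcoeffE n hn m
          rw [hE0 n hn m hm.le] at h1
          refine (mul_eq_zero.mp h1).resolve_left fun h2 => ?_
          have : n * m = s := by exact_mod_cast sub_eq_zero.mp h2
          omega
        · rw [redOp_one hn, ← neg_eq_iff_add_eq_zero, hE]
          congr 1
          ext m
          rw [← hcoeffE n hn m, coeff_sub, ← C_eq_natCast, ← C_eq_natCast, coeff_C_mul, coeff_C_mul]
          rcases m with _ | m
          · rw [mul_coeff_zero, coeff_X_zero]
            push_cast
            ring
          · rw [coeff_X_mul, coeff_derivative]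
            push_cast
            ring
  obtain ⟨G, hG⟩ := hmain
  refine ⟨G, (hG 0).1 rfl, fun s => ⟨(hG s).2.1, fun n hn => ⟨((hG s).2.2 n hn).1, ?_⟩⟩⟩
  rw [Finset.sum_range_succ, Nat.add_sub_cancel_left]
  exact ((hG s).2.2 n hn).2

end MirrorHG

namespace MirrorHG

open PowerSeries
open Finset.HasAntidiagonal (antidiagonal)

/-- The derivation `x d/dx` of `R[[x]]`. -/
noncomputable def xDeriv (R : Type*) [CommRing R] : IntDer R⟦X⟧ :=
  IntDer.ofAddHom ((AddMonoidHom.mulLeft (X : R⟦X⟧)).comp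
    (derivative R : R⟦X⟧ →ₗ[R] R⟦X⟧).toAddMonoidHom) fun f g => by simp; ring

lemma xDeriv_apply {R : Type*} [CommRing R] (f : R⟦X⟧) : xDeriv R f = X * derivative R f := rfl

lemma coeff_xDeriv {R : Type*} [CommRing R] (f : R⟦X⟧) (d : ℕ) :
    coeff d (xDeriv R f) = d * coeff d f := by
  rw [xDeriv_apply]
  rcases d with _ | d
  · simp
  · rw [coeff_succ_X_mul, coeff_derivative]
    push_cast
    ring

lemma xDeriv_C {R : Type*} [CommRing R] (a : R) : xDeriv R (C a) = 0 := by
  simp [xDeriv_apply]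

lemma xDeriv_aeval (f : ℚ⟦X⟧) (P : Polynomial ℚ) :
    xDeriv ℚ (Polynomial.aeval f P) = Polynomial.aeval f (Polynomial.derivative P) * xDeriv ℚ f := by
  rw [xDeriv_apply, xDeriv_apply, Derivation.map_aeval, smul_eq_mul]
  ring

lemma eq_zero_of_xDeriv_eq_zero {f : ℚ⟦X⟧} (h : xDeriv ℚ f = 0) (h0 : constantCoeff f = 0) :
    f = 0 := by
  ext d
  rcases d with _ | d
  · simpa using h0
  · have := congrArg (coeff (d + 1)) h
    rw [coeff_xDeriv, map_zero, mul_eq_zero] at this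
    rw [map_zero]
    exact this.resolve_left (by positivity)

section PropertiesOfL

variable {n : ℕ}

lemma constantCoeff_L (n : ℕ) : constantCoeff (L n) = 1 := by
  rw [L, ← coeff_zero_eq_constantCoeff_apply, coeff_rescale, pow_zero, one_mul,
    coeff_zero_eq_constantCoeff_apply, binomialSeries_constantCoeff]

lemma L_mul_inv (n : ℕ) : L n * (L n)⁻¹ = 1 :=
  PowerSeries.mul_inv_cancel _ (by rw [constantCoeff_L]; exact one_ne_zero)

lemma L_ne_zero (n : ℕ) : L n ≠ 0 := by
  intro h
  have := constantCoeff_L n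
  rw [h] at this
  simp at this

lemma L_pow_mul (hn : 1 ≤ n) : L n ^ n * (1 - C ((n : ℚ) ^ n) * X) = 1 := by
  have hn' : (n : ℚ) ≠ 0 := by positivity
  have hpow (k : ℕ) (r : ℚ) :
      (PowerSeries.binomialSeries ℚ r) ^ k = (PowerSeries.binomialSeries ℚ (k * r) : ℚ⟦X⟧) := by
    induction k with
    | zero => simp
    | succ k ih => rw [pow_succ, ih, ← binomialSeries_add]; congr 1; push_cast; ring
  have h1 : (PowerSeries.binomialSeries ℚ (-(1 / (n : ℚ)))) ^ n * (1 + X) = (1 : ℚ⟦X⟧) := by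
    have h2 : (1 + X : ℚ⟦X⟧) = PowerSeries.binomialSeries ℚ (1 : ℚ) := by
      simpa using (binomialSeries_nat (A := ℚ) (R := ℚ) 1).symm
    rw [hpow, h2, ← binomialSeries_add]
    have : (n : ℚ) * -(1 / (n : ℚ)) + 1 = 0 := by field_simp; ring
    rw [this, binomialSeries_zero]
  have h3 := congrArg (rescale (-((n : ℚ) ^ n))) h1
  rw [map_mul, map_pow, map_add, map_one, rescale_X] at h3
  have hneg : (C (-((n : ℚ) ^ n)) : ℚ⟦X⟧) = -C ((n : ℚ) ^ n) := map_neg _ _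
  rw [hneg] at h3
  rw [L]
  linear_combination h3

lemma natCast_pow_X_mul_L_pow (hn : 1 ≤ n) : C ((n : ℚ) ^ n) * X * L n ^ n = L n ^ n - 1 := by
  linear_combination -L_pow_mul hn

/-- The logarithmic derivative `(L ^ n - 1) / n` of `L`. -/
noncomputable def logDerivL (n : ℕ) : ℚ⟦X⟧ := C (n : ℚ)⁻¹ * (L n ^ n - 1)

lemma natCast_mul_logDerivL (hn : 1 ≤ n) : (n : ℚ⟦X⟧) * logDerivL n = L n ^ n - 1 := by
  have hn' : (n : ℚ) ≠ 0 := by positivity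
  rw [logDerivL, ← mul_assoc, ← map_natCast (C : ℚ →+* ℚ⟦X⟧), ← map_mul, mul_inv_cancel₀ hn',
    map_one, one_mul]

lemma xDeriv_L (hn : 1 ≤ n) : xDeriv ℚ (L n) = logDerivL n * L n := by
  have hn' : (n : ℚ) ≠ 0 := by positivity
  have hn0 : (n : ℚ⟦X⟧) ≠ 0 := by
    rw [← map_natCast (C : ℚ →+* ℚ⟦X⟧)]
    exact fun h => hn' (by simpa using congrArg constantCoeff h)
  have h1 := congrArg (xDeriv ℚ) (L_pow_mul hn)
  have h2 : xDeriv ℚ (1 - C ((n : ℚ) ^ n) * X) = -(C ((n : ℚ) ^ n) * X) := by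
    simp [xDeriv_apply, mul_comm]
  rw [IntDer.map_mul, IntDer.map_pow, h2, IntDer.map_one] at h1
  have h3 : (n : ℚ⟦X⟧) * L n ^ (n - 1) * (1 - C ((n : ℚ) ^ n) * X) ≠ 0 := by
    refine mul_ne_zero (mul_ne_zero hn0 (pow_ne_zero _ (L_ne_zero n))) fun h => ?_
    have := L_pow_mul hn
    rw [h, mul_zero] at this
    exact zero_ne_one this
  refine mul_left_cancel₀ h3 ?_
  have h4 : L n ^ (n - 1) * L n = L n ^ n := by rw [← pow_succ, Nat.sub_add_cancel hn]
  linear_combination h1 - natCast_mul_logDerivL hn * (L n ^ (n - 1) * L n) *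
    (1 - C ((n : ℚ) ^ n) * X) - (L n ^ n - 1) * (1 - C ((n : ℚ) ^ n) * X) * h4
    - (L n ^ n - 1) * L_pow_mul hn + natCast_pow_X_mul_L_pow hn

lemma xDeriv_L_pow (hn : 1 ≤ n) : xDeriv ℚ (L n ^ n) = L n ^ n * (L n ^ n - 1) := by
  have h4 : L n ^ (n - 1) * L n = L n ^ n := by rw [← pow_succ, Nat.sub_add_cancel hn]
  rw [IntDer.map_pow, xDeriv_L hn]
  linear_combination (n : ℚ⟦X⟧) * logDerivL n * h4 + L n ^ n * natCast_mul_logDerivL hn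

lemma xDeriv_L_mul_inv_pow (hn : 1 ≤ n) (i : ℕ) : xDeriv ℚ (L n * (L n)⁻¹ ^ i) =
    (1 - (i : ℚ⟦X⟧)) * logDerivL n * (L n * (L n)⁻¹ ^ i) := by
  have hinv : xDeriv ℚ (L n)⁻¹ = -logDerivL n * (L n)⁻¹ := by
    have h1 := congrArg (xDeriv ℚ) (L_mul_inv n)
    rw [IntDer.map_mul, IntDer.map_one, xDeriv_L hn] at h1
    linear_combination (L n)⁻¹ * h1 - (xDeriv ℚ (L n)⁻¹ + logDerivL n * (L n)⁻¹) * L_mul_inv n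
  induction i with
  | zero => simp [xDeriv_L hn]
  | succ i ih =>
    rw [pow_succ, ← mul_assoc, IntDer.map_mul, ih, hinv]
    push_cast
    ring

end PropertiesOfL

section Operators

lemma H_zero_right (n m : ℕ) : H n m 0 = 1 := by
  induction m with
  | zero => simp [H]
  | succ m ih => rw [H, ih]

lemma aeval_H_succ_succ {n : ℕ} (hn : 1 ≤ n) (m j : ℕ) :
    Polynomial.aeval (L n ^ n) (H n (m + 1) (j + 1)) = Polynomial.aeval (L n ^ n) (H n m (j + 1)) +
      (xDeriv ℚ (Polynomial.aeval (L n ^ n) (H n m j)) +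
        ((m : ℚ⟦X⟧) - j) * logDerivL n * Polynomial.aeval (L n ^ n) (H n m j)) := by
  have hC : (PowerSeries.C ((((m + 1 : ℕ) : ℚ) - ((j + 1 : ℕ) : ℚ)) / (n : ℚ)) : ℚ⟦X⟧) =
      ((m : ℚ⟦X⟧) - j) * PowerSeries.C (n : ℚ)⁻¹ := by
    rw [← map_natCast (PowerSeries.C : ℚ →+* ℚ⟦X⟧) m, ← map_natCast (PowerSeries.C : ℚ →+* ℚ⟦X⟧) j,
      ← map_sub, ← map_mul]
    congr 1
    push_cast
    ring
  rw [H, xDeriv_aeval, xDeriv_L_pow hn, logDerivL]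
  simp only [map_add, map_mul, map_sub, map_one, Polynomial.aeval_X, Polynomial.aeval_C]
  rw [show algebraMap ℚ ℚ⟦X⟧ = PowerSeries.C from rfl, hC]
  ring

lemma powCoeff_eq_sum_H {n : ℕ} (hn : 1 ≤ n) (m j : ℕ) (f : ℚ⟦X⟧) :
    powCoeff (xDeriv ℚ) (logDerivL n) 0 m j f = ∑ i ∈ Finset.range (j + 1),
      (m.choose i : ℚ⟦X⟧) * Polynomial.aeval (L n ^ n) (H n (m - i) (j - i)) * D^[i] f := by
  have hD (f : ℚ⟦X⟧) : D f = xDeriv ℚ f := rfl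
  induction m generalizing j with
  | zero =>
    rcases j with _ | j
    · simp [H]
    · rw [powCoeff_zero_succ, Finset.sum_eq_zero]
      rintro (_ | i) _ <;> simp [H]
  | succ m ih =>
    rcases j with _ | j
    · simp [H_zero_right]
    · rw [powCoeff_succ_succ, ih, ih]
      set h : ℕ → ℕ → ℚ⟦X⟧ := fun m j => Polynomial.aeval (L n ^ n) (H n m j) with hh
      have hbeta (m j : ℕ) : Polynomial.aeval (L n ^ n) (H n m j) = h m j := rfl
      simp only [hbeta]
      have h1 : ∑ i ∈ Finset.range (j + 1 + 1),
          ((m + 1).choose i : ℚ⟦X⟧) * h (m + 1 - i) (j + 1 - i) * D^[i] f =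
          ∑ i ∈ Finset.range (j + 1 + 1), (m.choose i : ℚ⟦X⟧) * h (m + 1 - i) (j + 1 - i) * D^[i] f
          + ∑ i ∈ Finset.range (j + 1), (m.choose i : ℚ⟦X⟧) * h (m - i) (j - i) * D^[i + 1] f := by
        rw [Finset.sum_range_succ', Finset.sum_range_succ' _ (j + 1), add_right_comm,
          ← Finset.sum_add_distrib]
        congr 1
        · refine Finset.sum_congr rfl fun i _ => ?_
          rw [Nat.choose_succ_succ, Nat.add_sub_add_right, Nat.add_sub_add_right]
          push_cast
          ring
        · simp
      have h2 : ∑ i ∈ Finset.range (j + 1 + 1),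
          (m.choose i : ℚ⟦X⟧) * h (m + 1 - i) (j + 1 - i) * D^[i] f =
          ∑ i ∈ Finset.range (j + 1 + 1), (m.choose i : ℚ⟦X⟧) * h (m - i) (j + 1 - i) * D^[i] f +
          ∑ i ∈ Finset.range (j + 1), (m.choose i : ℚ⟦X⟧) * (xDeriv ℚ (h (m - i) (j - i)) +
            ((m : ℚ⟦X⟧) - j) * logDerivL n * h (m - i) (j - i)) * D^[i] f := by
        rw [Finset.sum_range_succ, Finset.sum_range_succ _ (j + 1), add_right_comm,
          ← Finset.sum_add_distrib]
        congr 1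
        · refine Finset.sum_congr rfl fun i hi => ?_
          have hij : i ≤ j := Nat.lt_succ_iff.mp (Finset.mem_range.mp hi)
          rcases le_or_gt i m with him | him
          · have h3 := aeval_H_succ_succ hn (m - i) (j - i)
            simp only [hbeta] at h3
            rw [Nat.sub_add_comm him, Nat.sub_add_comm hij, h3, Nat.cast_sub him, Nat.cast_sub hij]
            ring
          · rw [Nat.choose_eq_zero_of_lt him]
            simp
        · simp [hh, H_zero_right]
      rw [h1, h2, map_sum, Finset.mul_sum, add_assoc, add_assoc, ← Finset.sum_add_distrib,
        ← Finset.sum_add_distrib]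
      congr 1
      refine Finset.sum_congr rfl fun i _ => ?_
      rw [IntDer.map_mul, IntDer.map_mul, IntDer.map_natCast, Function.iterate_succ_apply', hD]
      ring

/-- The operator `opL n k`, as the coefficient of `(L w) ^ (n - k)` in a differential operator. -/
noncomputable def symL (n k : ℕ) : ℚ⟦X⟧ →+ ℚ⟦X⟧ :=
  symbolCoeff (xDeriv ℚ) (logDerivL n) 0 (L n ^ n - 1) (fun r => C (S r n / (n : ℚ) ^ r)) n k

lemma opL_eq_symL {n : ℕ} (hn : 1 ≤ n) (k : ℕ) (f : ℚ⟦X⟧) : opL n k f = symL n k f := by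
  rw [symL, symbolCoeff_apply, opL]
  generalize L n ^ n - 1 = q
  simp only [powCoeff_eq_sum_H hn, sub_mul, Finset.sum_sub_distrib]
  congr 1
  simp only [Finset.mul_sum, Finset.sum_mul]
  have hiff (i r : ℕ) : i ∈ Finset.range (k + 1) ∧ r ∈ Finset.Icc 1 (k - i) ↔
      i ∈ Finset.range (k - r + 1) ∧ r ∈ Finset.Icc 1 k := by
    simp only [Finset.mem_Icc, Finset.mem_range]
    omega
  rw [Finset.sum_comm' hiff]
  refine Finset.sum_congr rfl fun r _ => Finset.sum_congr rfl fun i _ => ?_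
  rw [Nat.sub_right_comm n i r, Nat.sub_right_comm k i r, map_mul, map_natCast]
  ring

lemma symL_eq_zero_of_lt {n k : ℕ} (h : n < k) (f : ℚ⟦X⟧) : symL n k f = 0 :=
  symbolCoeff_eq_zero_of_lt _ _ _ _ _ (fun r hr => by simp [S_eq_zero_of_lt hr]) h f

lemma symL_one {n : ℕ} (hn : 1 ≤ n) (f : ℚ⟦X⟧) :
    symL n 1 f = (n : ℚ⟦X⟧) * (xDeriv ℚ f - logDerivL n * f) := by
  have hn' : (n : ℚ) ≠ 0 := by positivity
  have hσ : 2 * C (S 1 n / (n : ℚ) ^ 1) = (n : ℚ⟦X⟧) + 1 := by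
    rw [← map_natCast (C : ℚ →+* ℚ⟦X⟧), ← map_one (C : ℚ →+* ℚ⟦X⟧), ← map_add,
      ← map_ofNat (C : ℚ →+* ℚ⟦X⟧) 2, ← map_mul, ← mul_div_assoc, two_mul_S_one, pow_one,
      mul_div_cancel_left₀ _ hn']
  have hC2 : (2 : ℚ⟦X⟧) ≠ 0 := by
    rw [← map_ofNat (C : ℚ →+* ℚ⟦X⟧) 2]
    exact fun h => two_ne_zero (α := ℚ) (by simpa using congrArg constantCoeff h)
  have h := symbolCoeff_one (xDeriv ℚ) (logDerivL n) 0 (n := n) (q := L n ^ n - 1)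
    (σ := fun r => C (S r n / (n : ℚ) ^ r)) (natCast_mul_logDerivL hn).symm hσ f
  rw [symL, mul_left_cancel₀ hC2 h]
  ring

lemma odeLHS_eq_sum_antidiagonal {n : ℕ} (hn : 1 ≤ n) (Phi : ℕ → ℚ⟦X⟧) (s : ℕ) :
    odeLHS n Phi s =
      ∑ p ∈ antidiagonal s, (L n)⁻¹ ^ p.1 * symL n (p.1 + 1) (Phi p.2) := by
  rw [odeLHS, sum_Icc_one_eq, Finset.Nat.sum_antidiagonal_eq_sum_range_succ_mk]
  simp only [opL_eq_symL hn, Nat.add_sub_cancel, Nat.add_le_add_iff_right, Nat.add_sub_add_right]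
  have h1 : ∀ k ∈ Finset.range (max n (s + 1)), k ∉ Finset.range n →
      (L n)⁻¹ ^ k * symL n (k + 1) (if k ≤ s then Phi (s - k) else 0) = 0 := by
    intro k _ hk
    rw [symL_eq_zero_of_lt (by simpa [Nat.lt_succ_iff] using hk), mul_zero]
  have h2 : ∀ k ∈ Finset.range (max n (s + 1)), k ∉ Finset.range (s + 1) →
      (L n)⁻¹ ^ k * symL n (k + 1) (if k ≤ s then Phi (s - k) else 0) = 0 := by
    intro k _ hk
    rw [if_neg (by simpa [Nat.lt_succ_iff] using hk), map_zero, mul_zero]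
  rw [Finset.sum_subset (by intro x; simp; omega) h1,
    ← Finset.sum_subset (by intro x; simp; omega) h2]
  refine Finset.sum_congr rfl fun k hk => ?_
  rw [if_pos (Nat.lt_succ_iff.mp (Finset.mem_range.mp hk))]

lemma SolvesODE.unique {n : ℕ} (hn : 1 ≤ n) {Phi Phi' : ℕ → ℚ⟦X⟧} (h : SolvesODE n Phi)
    (h' : SolvesODE n Phi') : Phi' = Phi := by
  have hn' : (n : ℚ) ≠ 0 := by positivity
  have hn0 : (n : ℚ⟦X⟧) ≠ 0 := by
    rw [← map_natCast (C : ℚ →+* ℚ⟦X⟧)]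
    exact fun h => hn' (by simpa using congrArg constantCoeff h)
  funext s
  induction s using Nat.strong_induction_on with
  | _ s ih =>
    have h1 := h.1 s
    have h2 := h'.1 s
    rw [odeLHS_eq_sum_antidiagonal hn, Finset.Nat.sum_antidiagonal_eq_sum_range_succ_mk,
      Finset.sum_range_succ'] at h1 h2
    have h3 : ∀ k ∈ Finset.range s, (L n)⁻¹ ^ (k + 1) * symL n (k + 1 + 1) (Phi' (s - (k + 1))) =
        (L n)⁻¹ ^ (k + 1) * symL n (k + 1 + 1) (Phi (s - (k + 1))) := by
      intro k hk
      have := Finset.mem_range.mp hk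
      rw [ih _ (by omega)]
    rw [Finset.sum_congr rfl h3, ← h1] at h2
    have h4 := add_left_cancel h2
    simp only [pow_zero, one_mul, zero_add, Nat.sub_zero] at h4
    rw [← sub_eq_zero, ← map_sub, symL_one hn] at h4
    have h5 := (mul_eq_zero.mp h4).resolve_left hn0
    have h6 : (Phi' s - Phi s) * (L n)⁻¹ = 0 := by
      refine eq_zero_of_xDeriv_eq_zero ?_ ?_
      · have h7 := xDeriv_L_mul_inv_pow hn 2
        have h8 : L n * (L n)⁻¹ ^ 2 = (L n)⁻¹ := by linear_combination (L n)⁻¹ * L_mul_inv n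
        rw [h8] at h7
        rw [IntDer.map_mul, h7]
        push_cast
        linear_combination (L n)⁻¹ * h5
      · rw [map_mul, map_sub, h.2, h'.2, sub_self, zero_mul]
    have h9 : (L n)⁻¹ ≠ 0 := fun h0 => by
      have := L_mul_inv n
      rw [h0, mul_zero] at this
      exact zero_ne_one this
    exact sub_eq_zero.mp ((mul_eq_zero.mp h6).resolve_right h9)

lemma symL_L_mul {n : ℕ} (hn : 1 ≤ n) (i k : ℕ) (G : Polynomial ℚ) :
    symL n k (L n * (L n)⁻¹ ^ i * Polynomial.aeval (L n ^ n) G) =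
      L n * (L n)⁻¹ ^ i * Polynomial.aeval (L n ^ n) (redOp n i k G) := by
  have h := map_symbolCoeff (polyDeriv (Polynomial.X * (Polynomial.X - 1)))
    (Polynomial.C (n : ℚ)⁻¹ * (Polynomial.X - 1)) (1 - (i : Polynomial ℚ))
    (Polynomial.aeval (L n ^ n) : Polynomial ℚ →ₐ[ℚ] ℚ⟦X⟧).toRingHom (xDeriv ℚ)
    (fun f => by
      rw [polyDeriv_apply]
      change Polynomial.aeval (L n ^ n) _ = xDeriv ℚ (Polynomial.aeval (L n ^ n) f)
      rw [xDeriv_aeval, xDeriv_L_pow hn]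
      simp
      ring) (Polynomial.X - 1) (fun r => Polynomial.C (S r n / (n : ℚ) ^ r)) n k G
  rw [symL, symbolCoeff_mul _ _ _ (xDeriv_L_mul_inv_pow hn i), redOp]
  congr 1
  refine Eq.trans ?_ h.symm
  simp [logDerivL, Polynomial.aeval_C]

end Operators

end MirrorHG

namespace MirrorHG

open PowerSeries
open Finset.HasAntidiagonal (antidiagonal)

section Evaluation

lemma exists_ratFunc_of_mem_regularFun {c : ℕ → ℚ} (hc : c ∈ regularFun) :
    ∃ r : RatFunc ℚ, ∀ n : ℕ, 1 ≤ n → r.denom.eval (n : ℚ) ≠ 0 ∧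
      RatFunc.eval (RingHom.id ℚ) (n : ℚ) r = c n := by
  obtain ⟨p, q, hpq⟩ := hc
  have hq : q ≠ 0 := by
    rintro rfl
    simpa using (hpq 1 le_rfl).1
  refine ⟨algebraMap _ _ p / algebraMap _ _ q, fun n hn => ?_⟩
  obtain ⟨h1, h2⟩ := hpq n hn
  set r : RatFunc ℚ := algebraMap _ _ p / algebraMap _ _ q with hr
  have hd : r.denom.eval (n : ℚ) ≠ 0 := by
    intro h
    obtain ⟨t, ht⟩ := RatFunc.denom_div_dvd p q
    rw [ht, Polynomial.eval_mul, ← hr, h, zero_mul] at h1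
    exact h1 rfl
  refine ⟨hd, ?_⟩
  have hmul : r * algebraMap _ _ q = algebraMap _ _ p :=
    div_mul_cancel₀ _ (RatFunc.algebraMap_ne_zero hq)
  have h3 := congrArg (RatFunc.eval (RingHom.id ℚ) (n : ℚ)) hmul
  rw [RatFunc.eval_mul _ _ (by simpa [Polynomial.eval₂_id] using hd) (by simp),
    RatFunc.eval_algebraMap, RatFunc.eval_algebraMap] at h3
  simp only [Polynomial.eval₂_id, Algebra.algebraMap_self, RingHom.id_apply] at h3
  rw [h2, eq_div_iff h1, h3]

lemma evalAt_eq_sum (Psi : MvPolynomial (Fin 3) (RatFunc ℚ)) (t : ℚ) (A B E : ℚ⟦X⟧)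
    {s : Finset (Fin 3 →₀ ℕ)} (hs : Psi.support ⊆ s) :
    evalAt Psi t A B E = ∑ e ∈ s, C (RatFunc.eval (RingHom.id ℚ) t (Psi.coeff e)) *
      (A ^ e 0 * B ^ e 1 * E ^ e 2) := by
  refine Finset.sum_subset hs fun e _ he => ?_
  rw [MvPolynomial.notMem_support_iff.mp he, RatFunc.eval_zero, map_zero, zero_mul]

/-- The families of power series `Ψ(n, L, L⁻¹, L ^ n)`, where `Ψ` is regular at all `n ≥ 1`. -/
def UniformSeries (F : ℕ → ℚ⟦X⟧) : Prop :=
  ∃ Psi : MvPolynomial (Fin 3) (RatFunc ℚ), ∀ n : ℕ, 1 ≤ n → RegularAt Psi (n : ℚ) ∧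
    F n = evalAt Psi (n : ℚ) (L n) (L n)⁻¹ (L n ^ n)

namespace UniformSeries

lemma zero : UniformSeries fun _ => 0 :=
  ⟨0, fun n _ => ⟨fun e => by simp, by simp [evalAt]⟩⟩

lemma add {F F' : ℕ → ℚ⟦X⟧} (h : UniformSeries F) (h' : UniformSeries F') :
    UniformSeries fun n => F n + F' n := by
  classical
  obtain ⟨P, hP⟩ := h
  obtain ⟨P', hP'⟩ := h'
  refine ⟨P + P', fun n hn => ?_⟩
  obtain ⟨h1, h2⟩ := hP n hn
  obtain ⟨h3, h4⟩ := hP' n hn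
  constructor
  · intro e h0
    obtain ⟨t, ht⟩ := RatFunc.denom_add_dvd (P.coeff e) (P'.coeff e)
    rw [MvPolynomial.coeff_add] at h0
    have := congrArg (Polynomial.eval (n : ℚ)) ht
    rw [Polynomial.eval_mul, Polynomial.eval_mul, h0, zero_mul] at this
    exact mul_ne_zero (h1 e) (h3 e) this
  · beta_reduce
    rw [h2, h4, evalAt_eq_sum P _ _ _ _ (Finset.subset_union_left (s₂ := P'.support)),
      evalAt_eq_sum P' _ _ _ _ (Finset.subset_union_right (s₁ := P.support)),
      evalAt_eq_sum (P + P') _ _ _ _ MvPolynomial.support_add, ← Finset.sum_add_distrib]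
    refine Finset.sum_congr rfl fun e _ => ?_
    rw [MvPolynomial.coeff_add, RatFunc.eval_add _ _ (by simpa [Polynomial.eval₂_id] using h1 e)
      (by simpa [Polynomial.eval₂_id] using h3 e), map_add, add_mul]

lemma sum {ι : Type*} (s : Finset ι) {F : ι → ℕ → ℚ⟦X⟧} (h : ∀ i ∈ s, UniformSeries (F i)) :
    UniformSeries fun n => ∑ i ∈ s, F i n := by
  classical
  induction s using Finset.induction_on with
  | empty => simpa using zero
  | insert a s ha ih =>
    simp only [Finset.sum_insert ha]
    exact (h a (Finset.mem_insert_self a s)).add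
      (ih fun i hi => h i (Finset.mem_insert_of_mem hi))

lemma term {c : ℕ → ℚ} (hc : c ∈ regularFun) (i j k : ℕ) :
    UniformSeries fun n => C (c n) * (L n ^ i * (L n)⁻¹ ^ j * (L n ^ n) ^ k) := by
  classical
  obtain ⟨r, hr⟩ := exists_ratFunc_of_mem_regularFun hc
  set e : Fin 3 →₀ ℕ := Finsupp.equivFunOnFinite.symm ![i, j, k] with he
  refine ⟨MvPolynomial.monomial e r, fun n hn => ⟨fun e' => ?_, ?_⟩⟩
  · rw [MvPolynomial.coeff_monomial]
    split_ifs
    · exact (hr n hn).1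
    · simp
  · rw [evalAt_eq_sum _ _ _ _ _ MvPolynomial.support_monomial_subset, Finset.sum_singleton,
      MvPolynomial.coeff_monomial, if_pos rfl, (hr n hn).2]
    simp [he]

end UniformSeries

end Evaluation

lemma sum_antidiagonal_triple_comm {M : Type*} [AddCommMonoid M] (F : ℕ → ℕ → ℕ → M) (s : ℕ) :
    ∑ p ∈ antidiagonal s, ∑ q ∈ antidiagonal p.2, F p.1 q.1 q.2 =
      ∑ p ∈ antidiagonal s, ∑ q ∈ antidiagonal p.2, F q.1 p.1 q.2 := by
  rw [Finset.sum_sigma', Finset.sum_sigma']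
  refine Finset.sum_bij' (fun x _ => ⟨(x.2.1, x.1.1 + x.2.2), (x.1.1, x.2.2)⟩)
    (fun x _ => ⟨(x.2.1, x.1.1 + x.2.2), (x.1.1, x.2.2)⟩) ?_ ?_ ?_ ?_ ?_
  · rintro ⟨⟨a, b⟩, c, d⟩ h
    simp only [Finset.mem_sigma, Finset.HasAntidiagonal.mem_antidiagonal] at h ⊢
    exact ⟨by omega, trivial⟩
  · rintro ⟨⟨a, b⟩, c, d⟩ h
    simp only [Finset.mem_sigma, Finset.HasAntidiagonal.mem_antidiagonal] at h ⊢
    exact ⟨by omega, trivial⟩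
  · rintro ⟨⟨a, b⟩, c, d⟩ h
    simp only [Finset.mem_sigma, Finset.HasAntidiagonal.mem_antidiagonal] at h
    obtain ⟨_, rfl⟩ := h
    rfl
  · rintro ⟨⟨a, b⟩, c, d⟩ h
    simp only [Finset.mem_sigma, Finset.HasAntidiagonal.mem_antidiagonal] at h
    obtain ⟨_, rfl⟩ := h
    rfl
  · simp

lemma exists_uniform_solution : ∃ Phi : ℕ → ℕ → ℚ⟦X⟧,
    (∀ n, 1 ≤ n → SolvesODE n (Phi n)) ∧
    (∀ n, 1 ≤ n → ∀ s, ∃ P : Polynomial ℚ, Phi n s = L n * Polynomial.aeval (L n) P) ∧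
    ∀ s, UniformSeries fun n => Phi n s := by
  obtain ⟨G, hG0, hG⟩ := exists_normalized_solution
  have hcoeff (i : ℕ) : ∃ M, ∀ n, (G i n).natDegree < M := by
    obtain ⟨M, hM⟩ := (hG i).1.1
    exact ⟨M + 1, fun n => Nat.lt_succ_of_le
      (Polynomial.natDegree_le_iff_coeff_eq_zero.mpr fun m hm => hM n m hm.le)⟩
  choose M hM using hcoeff
  set γ : ℕ → ℕ → ℚ := fun n i => (G i n).eval 1 with hγ
  have hγ_mem (i : ℕ) : (fun n => γ n i) ∈ regularFun := by
    have h1 : (fun n => γ n i) = fun n => ∑ m ∈ Finset.range (M i), (G i n).coeff m := by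
      ext n
      simp only [hγ]
      rw [Polynomial.eval_eq_sum_range' (hM i n)]
      simp
    rw [h1]
    exact regularFun_sum _ _ fun m _ => (hG i).1.2 m
  set κ : ℕ → ℕ → ℚ := fun n j => coeff j (PowerSeries.mk (γ n))⁻¹ with hκ
  have hκγ (n s : ℕ) : ∑ p ∈ antidiagonal s, κ n p.1 * γ n p.2 = if s = 0 then 1 else 0 := by
    have h1 : (PowerSeries.mk (γ n))⁻¹ * PowerSeries.mk (γ n) = 1 := by
      refine PowerSeries.inv_mul_cancel _ ?_
      rw [← coeff_zero_eq_constantCoeff_apply, coeff_mk]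
      simp [hγ, hG0]
    have h2 := congrArg (coeff s) h1
    rw [coeff_mul, coeff_one] at h2
    simpa using h2
  have hκ_mem (j : ℕ) : (fun n => κ n j) ∈ regularFun := by
    induction j using Nat.strong_induction_on with
    | _ j ih =>
      have h1 : (fun n => κ n j) = (fun _ => if j = 0 then 1 else 0) -
          fun n => ∑ i ∈ Finset.range j, κ n i * γ n (j - i) := by
        ext n
        have h2 := hκγ n j
        rw [Finset.Nat.sum_antidiagonal_eq_sum_range_succ_mk, Finset.sum_range_succ] at h2
        simp only [Nat.sub_self] at h2
        rw [show γ n 0 = 1 by simp [hγ, hG0], mul_one] at h2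
        rw [Pi.sub_apply, ← h2]
        ring
      rw [h1]
      exact sub_mem (const_mem_regularFun _) (regularFun_sum _ _ fun i hi =>
        mul_mem (ih i (Finset.mem_range.mp hi)) (hγ_mem (j - i)))
  set N : ℕ → ℕ → ℚ⟦X⟧ := fun n i =>
    L n * (L n)⁻¹ ^ i * Polynomial.aeval (L n ^ n) (G i n) with hN
  have hNsum (n i : ℕ) : N n i = ∑ m ∈ Finset.range (M i),
      C ((G i n).coeff m) * (L n ^ 1 * (L n)⁻¹ ^ i * (L n ^ n) ^ m) := by
    simp only [hN]
    rw [Polynomial.aeval_eq_sum_range' (hM i n), Finset.mul_sum]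
    refine Finset.sum_congr rfl fun m _ => ?_
    rw [PowerSeries.smul_eq_C_mul]
    ring
  refine ⟨fun n s => ∑ p ∈ antidiagonal s, C (κ n p.1) * N n p.2, fun n hn => ⟨fun s => ?_,
    fun s => ?_⟩, fun n hn s => ?_, fun s => ?_⟩
  · have hsymC (a : ℚ) (k : ℕ) (f : ℚ⟦X⟧) : symL n k (C a * f) = C a * symL n k f := by
      have h1 := symbolCoeff_mul (xDeriv ℚ) (logDerivL n) 0 (u := C a) (c := 0)
        (by rw [xDeriv_C]; simp) (L n ^ n - 1) (fun r => C (S r n / (n : ℚ) ^ r)) n k f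
      rwa [add_zero] at h1
    have hnorm (s : ℕ) : ∑ p ∈ antidiagonal s, (L n)⁻¹ ^ p.1 * symL n (p.1 + 1) (N n p.2) = 0 := by
      have h1 : ∀ p ∈ antidiagonal s, (L n)⁻¹ ^ p.1 * symL n (p.1 + 1) (N n p.2) =
          L n * (L n)⁻¹ ^ s *
            Polynomial.aeval (L n ^ n) (redOp n p.2 (s + 1 - p.2) (G p.2 n)) := by
        intro p hp
        have hp' := Finset.HasAntidiagonal.mem_antidiagonal.mp hp
        simp only [hN]
        rw [symL_L_mul hn, ← hp', show p.1 + p.2 + 1 - p.2 = p.1 + 1 by omega]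
        ring
      rw [Finset.sum_congr rfl h1, ← Finset.mul_sum, ← map_sum,
        ← Finset.Nat.sum_antidiagonal_swap, Finset.Nat.sum_antidiagonal_eq_sum_range_succ_mk]
      simp only [Prod.swap]
      rw [((hG s).2 n hn).2, map_zero, mul_zero]
    rw [odeLHS_eq_sum_antidiagonal hn]
    simp only [map_sum, hsymC, Finset.mul_sum]
    rw [sum_antidiagonal_triple_comm fun a b c =>
      (L n)⁻¹ ^ a * (C (κ n b) * symL n (a + 1) (N n c))]
    refine Finset.sum_eq_zero fun p _ => ?_
    have h1 : ∀ q ∈ antidiagonal p.2,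
        (L n)⁻¹ ^ q.1 * (C (κ n p.1) * symL n (q.1 + 1) (N n q.2)) =
        C (κ n p.1) * ((L n)⁻¹ ^ q.1 * symL n (q.1 + 1) (N n q.2)) := fun q _ => by ring
    rw [Finset.sum_congr rfl h1, ← Finset.mul_sum, hnorm, mul_zero]
  · rw [map_sum, ← hκγ n s]
    refine Finset.sum_congr rfl fun p _ => ?_
    rw [map_mul, constantCoeff_C]
    congr 1
    rw [hNsum, map_sum]
    simp only [hγ]
    rw [Polynomial.eval_eq_sum_range' (hM p.2 n)]
    refine Finset.sum_congr rfl fun m _ => ?_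
    have hinv : constantCoeff (L n)⁻¹ = 1 := by
      simp [constantCoeff_L]
    simp [constantCoeff_L]
  · have h1 (i : ℕ) : ∃ P : Polynomial ℚ, N n i = L n * Polynomial.aeval (L n) P := by
      refine ⟨∑ m ∈ Finset.range (M i), Polynomial.C ((G i n).coeff m) *
        Polynomial.X ^ (n * m - i), ?_⟩
      rw [hNsum, map_sum, Finset.mul_sum]
      refine Finset.sum_congr rfl fun m _ => ?_
      rw [map_mul, Polynomial.aeval_C, map_pow, Polynomial.aeval_X,
        show algebraMap ℚ ℚ⟦X⟧ = PowerSeries.C from rfl]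
      rcases lt_or_ge (n * m) i with h2 | h2
      · rw [((hG i).2 n hn).1 m h2]
        simp
      · have h3 : (L n)⁻¹ ^ i * (L n ^ n) ^ m = L n ^ (n * m - i) := by
          rw [← pow_mul, ← Nat.sub_add_cancel h2, pow_add, Nat.add_sub_cancel, mul_left_comm,
            ← mul_pow, mul_comm (L n)⁻¹, L_mul_inv, one_pow, mul_one]
        rw [← h3]
        ring
    choose P hP using h1
    refine ⟨∑ p ∈ antidiagonal s, Polynomial.C (κ n p.1) * P p.2, ?_⟩
    rw [map_sum, Finset.mul_sum]
    refine Finset.sum_congr rfl fun p _ => ?_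
    rw [hP, map_mul, Polynomial.aeval_C, show algebraMap ℚ ℚ⟦X⟧ = PowerSeries.C from rfl]
    ring
  · refine UniformSeries.sum _ fun p _ => ?_
    simp only [hNsum, Finset.mul_sum, ← mul_assoc (C (κ _ p.1)), ← map_mul]
    exact UniformSeries.sum _ fun m _ => UniformSeries.term
      (mul_mem (hκ_mem p.1) ((hG p.2).1.2 m)) 1 p.2 m

end MirrorHG

namespace MirrorHG

open PowerSeries
open Finset.HasAntidiagonal (antidiagonal)

section BigO

namespace IsBigOAtInfinity

variable {f g : RatFunc ℚ} {k l : ℤ}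

lemma zero (k : ℤ) : IsBigOAtInfinity 0 k := Or.inl rfl

lemma mono (h : IsBigOAtInfinity f k) (hkl : k ≤ l) : IsBigOAtInfinity f l :=
  h.imp_right fun h => h.trans hkl

lemma add (hf : IsBigOAtInfinity f k) (hg : IsBigOAtInfinity g k) :
    IsBigOAtInfinity (f + g) k := by
  rcases eq_or_ne g 0 with rfl | hg0
  · rwa [add_zero]
  rcases eq_or_ne f 0 with rfl | hf0
  · rwa [zero_add]
  rcases eq_or_ne (f + g) 0 with h0 | h0
  · exact Or.inl h0
  · exact Or.inr ((RatFunc.intDegree_add_le hg0 h0).trans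
      (max_le (hf.resolve_left hf0) (hg.resolve_left hg0)))

lemma mul (hf : IsBigOAtInfinity f k) (hg : IsBigOAtInfinity g l) :
    IsBigOAtInfinity (f * g) (k + l) := by
  rcases eq_or_ne f 0 with rfl | hf0
  · rw [zero_mul]; exact zero _
  rcases eq_or_ne g 0 with rfl | hg0
  · rw [mul_zero]; exact zero _
  · exact Or.inr (by
      rw [RatFunc.intDegree_mul hf0 hg0]
      exact add_le_add (hf.resolve_left hf0) (hg.resolve_left hg0))

lemma neg (hf : IsBigOAtInfinity f k) : IsBigOAtInfinity (-f) k :=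
  hf.imp (fun h => by rw [h, neg_zero]) fun h => by rwa [RatFunc.intDegree_neg]

lemma sub (hf : IsBigOAtInfinity f k) (hg : IsBigOAtInfinity g k) :
    IsBigOAtInfinity (f - g) k := by
  rw [sub_eq_add_neg]
  exact hf.add hg.neg

lemma sum {ι : Type*} (s : Finset ι) {F : ι → RatFunc ℚ}
    (h : ∀ i ∈ s, IsBigOAtInfinity (F i) k) : IsBigOAtInfinity (∑ i ∈ s, F i) k := by
  classical
  induction s using Finset.induction_on with
  | empty => exact zero k
  | insert a s ha ih =>
    rw [Finset.sum_insert ha]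
    exact (h a (Finset.mem_insert_self a s)).add
      (ih fun i hi => h i (Finset.mem_insert_of_mem hi))

lemma C (a : ℚ) : IsBigOAtInfinity (RatFunc.C a) 0 := Or.inr (RatFunc.intDegree_C a).le

lemma of_algebraMap (a : ℚ) : IsBigOAtInfinity (algebraMap ℚ (RatFunc ℚ) a) 0 := by
  have : (algebraMap ℚ (RatFunc ℚ)) = RatFunc.C := Subsingleton.elim _ _
  rw [this]
  exact C a

lemma natCast (n : ℕ) : IsBigOAtInfinity (n : RatFunc ℚ) 0 := by
  simpa using C (n : ℚ)

lemma X : IsBigOAtInfinity RatFunc.X 1 := Or.inr RatFunc.intDegree_X.le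

lemma inv_X : IsBigOAtInfinity (RatFunc.X⁻¹) (-1) :=
  Or.inr (by rw [RatFunc.intDegree_inv, RatFunc.intDegree_X])

/-- Cancellation of a factor of known degree. -/
lemma of_mul (hg : g ≠ 0) (hl : l ≤ g.intDegree) (h : IsBigOAtInfinity (g * f) (l + k)) :
    IsBigOAtInfinity f k := by
  rcases eq_or_ne f 0 with rfl | hf0
  · exact zero k
  · have := h.resolve_left (mul_ne_zero hg hf0)
    rw [RatFunc.intDegree_mul hg hf0] at this
    exact Or.inr (by omega)

end IsBigOAtInfinity

lemma eq_zero_of_isBigOAtInfinity_C {a : ℚ} {k : ℤ} (hk : k < 0)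
    (h : IsBigOAtInfinity (RatFunc.C a) k) : a = 0 := by
  rcases h with h | h
  · simpa using h
  · rw [RatFunc.intDegree_C] at h
    omega

lemma RatFunc_X_add_pow_sub {n d : ℕ} (hn : 1 ≤ n) (hd : 1 ≤ d) :
    (RatFunc.X + (d : RatFunc ℚ)) ^ n - RatFunc.X ^ n ≠ 0 ∧
      ((n - 1 : ℕ) : ℤ) ≤ ((RatFunc.X + (d : RatFunc ℚ)) ^ n - RatFunc.X ^ n).intDegree := by
  set P : Polynomial ℚ := (Polynomial.X + Polynomial.C (d : ℚ)) ^ n - Polynomial.X ^ n with hP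
  have h1 : (RatFunc.X + (d : RatFunc ℚ)) ^ n - RatFunc.X ^ n =
      algebraMap (Polynomial ℚ) (RatFunc ℚ) P := by
    simp [hP, RatFunc.algebraMap_X]
  have h2 : P.coeff (n - 1) ≠ 0 := by
    rw [hP, Polynomial.coeff_sub, Polynomial.coeff_X_add_C_pow, Polynomial.coeff_X_pow,
      if_neg (by omega), Nat.sub_sub_self hn, sub_zero, pow_one]
    have : n.choose (n - 1) ≠ 0 := (Nat.choose_pos (Nat.sub_le n 1)).ne'
    have hd' : d ≠ 0 := by omega
    exact mul_ne_zero (by exact_mod_cast hd') (by exact_mod_cast this)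
  have h3 : P ≠ 0 := fun h => h2 (by rw [h, Polynomial.coeff_zero])
  rw [h1]
  refine ⟨RatFunc.algebraMap_ne_zero h3, ?_⟩
  rw [RatFunc.intDegree_polynomial]
  exact_mod_cast Polynomial.le_natDegree_of_ne_zero h2

/-- All coefficients of the power series `f` are `O(w ^ k)`. -/
def SeriesBigO (f : (RatFunc ℚ)⟦X⟧) (k : ℤ) : Prop := ∀ d, IsBigOAtInfinity (coeff d f) k

namespace SeriesBigO

variable {f g : (RatFunc ℚ)⟦X⟧} {k l : ℤ}

lemma zero (k : ℤ) : SeriesBigO 0 k := fun d => by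
  rw [map_zero]; exact IsBigOAtInfinity.zero k

lemma mono (h : SeriesBigO f k) (hkl : k ≤ l) : SeriesBigO f l := fun d => (h d).mono hkl

lemma add (hf : SeriesBigO f k) (hg : SeriesBigO g k) : SeriesBigO (f + g) k := fun d => by
  rw [map_add]; exact (hf d).add (hg d)

lemma sub (hf : SeriesBigO f k) (hg : SeriesBigO g k) : SeriesBigO (f - g) k := fun d => by
  rw [map_sub]; exact (hf d).sub (hg d)

lemma neg (hf : SeriesBigO f k) : SeriesBigO (-f) k := fun d => by
  rw [map_neg]; exact (hf d).neg

lemma mul (hf : SeriesBigO f k) (hg : SeriesBigO g l) : SeriesBigO (f * g) (k + l) := fun d => by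
  rw [coeff_mul]
  exact IsBigOAtInfinity.sum _ fun p _ => (hf p.1).mul (hg p.2)

lemma sum {ι : Type*} (s : Finset ι) {F : ι → (RatFunc ℚ)⟦X⟧}
    (h : ∀ i ∈ s, SeriesBigO (F i) k) : SeriesBigO (∑ i ∈ s, F i) k := fun d => by
  rw [map_sum]
  exact IsBigOAtInfinity.sum _ fun i hi => h i hi d

lemma xDeriv (hf : SeriesBigO f k) : SeriesBigO (xDeriv (RatFunc ℚ) f) k := fun d => by
  rw [coeff_xDeriv]
  simpa using (IsBigOAtInfinity.natCast d).mul (hf d)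

lemma C {a : RatFunc ℚ} (ha : IsBigOAtInfinity a k) : SeriesBigO (C a) k := fun d => by
  rw [coeff_C]
  split_ifs
  · exact ha
  · exact IsBigOAtInfinity.zero k

lemma map (f : ℚ⟦X⟧) : SeriesBigO (PowerSeries.map (algebraMap ℚ (RatFunc ℚ)) f) 0 := fun d => by
  rw [coeff_map]
  exact IsBigOAtInfinity.of_algebraMap _

lemma one : SeriesBigO 1 0 := by
  simpa using map 1

lemma pow (hf : SeriesBigO f k) (m : ℕ) : SeriesBigO (f ^ m) (m * k) := by
  induction m with
  | zero => simpa using one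
  | succ m ih =>
    rw [pow_succ]
    exact (ih.mul hf).mono (by push_cast; linarith)

lemma powCoeff {g e : (RatFunc ℚ)⟦X⟧} (hg : SeriesBigO g 0) (he : SeriesBigO e 0)
    (hf : SeriesBigO f k) (m j : ℕ) :
    SeriesBigO (powCoeff (MirrorHG.xDeriv (RatFunc ℚ)) g e m j f) k := by
  have hnat (m : ℕ) : SeriesBigO (m : (RatFunc ℚ)⟦X⟧) 0 := by
    simpa using map (m : ℚ⟦X⟧)
  induction m generalizing j with
  | zero =>
    rcases j with _ | j
    · simpa using hf
    · exact zero k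
  | succ m ih =>
    rcases j with _ | j
    · simpa using hf
    · rw [powCoeff_succ_succ]
      refine (ih (j + 1)).add ((ih j).xDeriv.add ?_)
      simpa using (((he.add (hnat m)).sub (hnat j)).mul hg).mul (ih j)

lemma symbolCoeff {g e q : (RatFunc ℚ)⟦X⟧} {σ : ℕ → (RatFunc ℚ)⟦X⟧} (hg : SeriesBigO g 0)
    (he : SeriesBigO e 0) (hq : SeriesBigO q 0) (hσ : ∀ r, SeriesBigO (σ r) 0)
    (hf : SeriesBigO f k) (n j : ℕ) :
    SeriesBigO (symbolCoeff (MirrorHG.xDeriv (RatFunc ℚ)) g e q σ n j f) k := by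
  rw [symbolCoeff_apply]
  refine (powCoeff hg he hf n j).sub ?_
  simpa using hq.mul (sum _ fun r _ => (hσ r).mul (powCoeff hg he hf (n - r) (j - r)))

end SeriesBigO

end BigO

lemma coeff_mul_of_forall_lt {R : Type*} [CommRing R] {f : R⟦X⟧} {d : ℕ}
    (hf : ∀ e < d, coeff e f = 0) (g : R⟦X⟧) :
    coeff d (f * g) = coeff d f * constantCoeff g := by
  rw [coeff_mul, Finset.sum_eq_single (d, 0)]
  · simp
  · rintro ⟨a, b⟩ hab hne
    have h := Finset.HasAntidiagonal.mem_antidiagonal.mp hab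
    dsimp only at h ⊢
    rw [hf a, zero_mul]
    rcases Nat.eq_zero_or_pos b with rfl | hb
    · exact absurd (by rw [← h, add_zero]) hne
    · omega
  · simp

section ExponentialFactor

lemma expNegMul_hasSubst {mu : ℚ⟦X⟧} (hmu : constantCoeff mu = 0) :
    HasSubst (-(C (RatFunc.X : RatFunc ℚ) * map (algebraMap ℚ (RatFunc ℚ)) mu)) := by
  refine HasSubst.of_constantCoeff_zero' ?_
  rw [map_neg, map_mul, ← coeff_zero_eq_constantCoeff_apply (map _ mu), coeff_map,
    coeff_zero_eq_constantCoeff_apply, hmu, map_zero, mul_zero, neg_zero]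

lemma map_xDeriv (f : ℚ⟦X⟧) : map (algebraMap ℚ (RatFunc ℚ)) (xDeriv ℚ f) =
    xDeriv (RatFunc ℚ) (map (algebraMap ℚ (RatFunc ℚ)) f) := by
  ext d
  rw [coeff_map, coeff_xDeriv, coeff_xDeriv, coeff_map, map_mul, map_natCast]

lemma xDeriv_expNegMul {mu : ℚ⟦X⟧} (hmu : constantCoeff mu = 0) :
    xDeriv (RatFunc ℚ) (expNegMul mu) =
      -(C (RatFunc.X : RatFunc ℚ) * map (algebraMap ℚ (RatFunc ℚ)) (xDeriv ℚ mu)) *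
        expNegMul mu := by
  rw [map_xDeriv, xDeriv_apply, expNegMul, derivative_subst (expNegMul_hasSubst hmu),
    derivative_exp, xDeriv_apply, map_neg, Derivation.leibniz, derivative_C]
  simp only [smul_eq_mul, mul_zero, add_zero]
  ring

lemma constantCoeff_expNegMul {mu : ℚ⟦X⟧} (hmu : constantCoeff mu = 0) :
    constantCoeff (expNegMul mu) = 1 := by
  have hs := expNegMul_hasSubst hmu
  obtain ⟨h, hh⟩ : X ∣ exp (RatFunc ℚ) - 1 := by
    rw [X_dvd_iff, map_sub, constantCoeff_exp, map_one, sub_self]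
  rw [expNegMul, sub_eq_iff_eq_add.mp hh, subst_add hs, subst_mul hs, subst_X hs,
    ← coe_substAlgHom hs, map_one, map_add, map_mul, map_neg, map_mul,
    ← coeff_zero_eq_constantCoeff_apply (map _ mu), coeff_map,
    coeff_zero_eq_constantCoeff_apply, hmu]
  simp

end ExponentialFactor

section UniquenessOfExpansion

lemma HasAsymptoticSeries.unique {f : RatFunc ℚ} {a b : ℕ → ℚ} (ha : HasAsymptoticSeries f a)
    (hb : HasAsymptoticSeries f b) : a = b := by
  funext s
  induction s using Nat.strong_induction_on with
  | _ s ih =>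
    have h1 := (hb (s + 1)).sub (ha (s + 1))
    have h0 : ∑ i ∈ Finset.range s, RatFunc.C (a i) * (RatFunc.X⁻¹ : RatFunc ℚ) ^ i =
        ∑ i ∈ Finset.range s, RatFunc.C (b i) * (RatFunc.X⁻¹ : RatFunc ℚ) ^ i :=
      Finset.sum_congr rfl fun i hi => by rw [ih i (Finset.mem_range.mp hi)]
    rw [Finset.sum_range_succ, Finset.sum_range_succ, h0] at h1
    have h2 : IsBigOAtInfinity ((RatFunc.X⁻¹) ^ s * RatFunc.C (a s - b s)) (-(s : ℤ) + (-1)) := by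
      convert h1 using 1
      · rw [map_sub]
        ring
      · push_cast
        ring
    have h3 := IsBigOAtInfinity.of_mul (pow_ne_zero s (inv_ne_zero RatFunc.X_ne_zero)) ?_ h2
    · exact sub_eq_zero.mp (eq_zero_of_isBigOAtInfinity_C (by norm_num) h3)
    · clear * -
      induction s with
      | zero => simp
      | succ s ih =>
        rw [pow_succ, RatFunc.intDegree_mul (pow_ne_zero s (inv_ne_zero RatFunc.X_ne_zero))
          (inv_ne_zero RatFunc.X_ne_zero), RatFunc.intDegree_inv, RatFunc.intDegree_X]
        push_cast
        linarith

lemma constantCoeff_hyperF (n : ℕ) : constantCoeff (hyperF n) = 1 := by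
  rw [← coeff_zero_eq_constantCoeff_apply, hyperF, coeff_mk]
  simp

lemma HasExpansion.unique {n : ℕ} {mu mu' : ℚ⟦X⟧} {Phi Phi' : ℕ → ℚ⟦X⟧}
    (h : HasExpansion n mu Phi) (h' : HasExpansion n mu' Phi') : mu' = mu ∧ Phi' = Phi := by
  have hO (mu : ℚ⟦X⟧) (Phi : ℕ → ℚ⟦X⟧) (h : HasExpansion n mu Phi) :
      SeriesBigO (expNegMul mu * hyperF n) 0 := fun d => by
    simpa using h.2 d 0
  have hc (mu : ℚ⟦X⟧) (hmu : constantCoeff mu = 0) :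
      constantCoeff (expNegMul mu * hyperF n) = 1 := by
    rw [map_mul, constantCoeff_expNegMul hmu, constantCoeff_hyperF, one_mul]
  have hmu : mu' = mu := by
    set f := expNegMul mu * hyperF n with hf
    set f' := expNegMul mu' * hyperF n with hf'
    have h1 : SeriesBigO (C (RatFunc.X : RatFunc ℚ) *
        (map (algebraMap ℚ (RatFunc ℚ)) (xDeriv ℚ (mu' - mu)) * (f * f'))) 0 := by
      have h2 := ((hO mu' Phi' h').mul (hO mu Phi h).xDeriv).sub
        ((hO mu Phi h).mul (hO mu' Phi' h').xDeriv)
      rw [add_zero] at h2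
      convert h2 using 1
      rw [IntDer.map_mul, IntDer.map_mul, xDeriv_expNegMul h.1, xDeriv_expNegMul h'.1, map_sub,
        map_sub]
      ring
    suffices hd : ∀ d, coeff d (xDeriv ℚ (mu' - mu)) = 0 by
      refine sub_eq_zero.mp (eq_zero_of_xDeriv_eq_zero (PowerSeries.ext hd) ?_)
      rw [map_sub, h.1, h'.1, sub_self]
    intro d
    induction d using Nat.strong_induction_on with
    | _ d ih =>
      have h2 := h1 d
      rw [coeff_C_mul, coeff_mul_of_forall_lt
        (fun e he => by rw [coeff_map, ih e he, map_zero]), map_mul, hc mu h.1, hc mu' h'.1,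
        mul_one, mul_one, coeff_map] at h2
      have h3 : (algebraMap ℚ (RatFunc ℚ)) = RatFunc.C := Subsingleton.elim _ _
      rw [h3] at h2
      exact eq_zero_of_isBigOAtInfinity_C (k := -1) (by norm_num)
        (IsBigOAtInfinity.of_mul (l := 1) RatFunc.X_ne_zero RatFunc.intDegree_X.ge
          (by simpa using h2))
  refine ⟨hmu, ?_⟩
  subst hmu
  funext s
  ext d
  exact congrFun (HasAsymptoticSeries.unique (h'.2 d) (h.2 d)) s

end UniquenessOfExpansion

end MirrorHG

namespace MirrorHG

open PowerSeries
open Finset.HasAntidiagonal (antidiagonal)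

section Expansion

/-- The inclusion of `ℚ[[x]]` into `ℚ(w)[[x]]`. -/
noncomputable abbrev toRat : ℚ⟦X⟧ →+* (RatFunc ℚ)⟦X⟧ := map (algebraMap ℚ (RatFunc ℚ))

/-- The variable `w` as an element of `ℚ(w)[[x]]`. -/
noncomputable abbrev wVar : (RatFunc ℚ)⟦X⟧ := C RatFunc.X

/-- The operator `x d/dx + w`. -/
noncomputable def shiftOp (f : (RatFunc ℚ)⟦X⟧) : (RatFunc ℚ)⟦X⟧ :=
  xDeriv (RatFunc ℚ) f + wVar * f

/-- The operator `x d/dx + L w`. -/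
noncomputable def conjOp (n : ℕ) (f : (RatFunc ℚ)⟦X⟧) : (RatFunc ℚ)⟦X⟧ :=
  xDeriv (RatFunc ℚ) f + toRat (L n) * wVar * f

/-- The operator `symL n k` on `ℚ(w)[[x]]`. -/
noncomputable def symRat (n k : ℕ) : (RatFunc ℚ)⟦X⟧ →+ (RatFunc ℚ)⟦X⟧ :=
  symbolCoeff (xDeriv (RatFunc ℚ)) (toRat (logDerivL n)) 0 (toRat (L n ^ n - 1))
    (fun r => toRat (C (S r n / (n : ℚ) ^ r))) n k

/-- The differential operator annihilating `e^{-μ w} F`. -/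
noncomputable def fullOp (n : ℕ) : (RatFunc ℚ)⟦X⟧ →+ (RatFunc ℚ)⟦X⟧ :=
  ∑ k ∈ Finset.range n, (AddMonoidHom.mulLeft ((toRat (L n) * wVar) ^ (n - (k + 1)))).comp
    (symRat n (k + 1))

lemma fullOp_apply (n : ℕ) (f : (RatFunc ℚ)⟦X⟧) : fullOp n f =
    ∑ k ∈ Finset.range n, (toRat (L n) * wVar) ^ (n - (k + 1)) * symRat n (k + 1) f := by
  simp [fullOp, AddMonoidHom.finsetSum_apply]

lemma symRat_toRat (n k : ℕ) (f : ℚ⟦X⟧) : symRat n k (toRat f) = toRat (symL n k f) := by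
  rw [symL, map_symbolCoeff _ _ _ toRat (xDeriv (RatFunc ℚ)) map_xDeriv, map_zero, symRat]

lemma symRat_C_mul (n k : ℕ) (a : RatFunc ℚ) (f : (RatFunc ℚ)⟦X⟧) :
    symRat n k (C a * f) = C a * symRat n k f := by
  have h := symbolCoeff_mul (xDeriv (RatFunc ℚ)) (toRat (logDerivL n)) 0 (u := C a) (c := 0)
    (by rw [xDeriv_C]; simp) (toRat (L n ^ n - 1)) (fun r => toRat (C (S r n / (n : ℚ) ^ r))) n k f
  rwa [add_zero] at h

lemma fullOp_eq {n : ℕ} (hn : 1 ≤ n) (f : (RatFunc ℚ)⟦X⟧) : fullOp n f =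
    (conjOp n)^[n] f - (toRat (L n) * wVar) ^ n * f - toRat (L n ^ n - 1) *
      ∑ r ∈ Finset.Icc 1 n, toRat (C (S r n / (n : ℚ) ^ r)) * (conjOp n)^[n - r] f := by
  have hp : xDeriv (RatFunc ℚ) (toRat (L n) * wVar) =
      toRat (logDerivL n) * (toRat (L n) * wVar) := by
    rw [IntDer.map_mul, xDeriv_C, ← map_xDeriv, xDeriv_L hn, map_mul]
    ring
  have h := sum_symbolCoeff (xDeriv (RatFunc ℚ)) (toRat (logDerivL n)) 0 hp (T := conjOp n)
    (fun f => by rw [conjOp]; ring) (toRat (L n ^ n - 1))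
    (fun r => toRat (C (S r n / (n : ℚ) ^ r))) n f
  rw [Finset.sum_range_succ', symbolCoeff_zero, Nat.sub_zero] at h
  rw [fullOp_apply, sub_right_comm, h, add_sub_cancel_right]
  rfl

lemma coeff_conjOp_of_forall_lt (n : ℕ) {f : (RatFunc ℚ)⟦X⟧} {d : ℕ}
    (hf : ∀ e < d, coeff e f = 0) :
    (∀ e < d, coeff e (conjOp n f) = 0) ∧
      coeff d (conjOp n f) = (RatFunc.X + (d : RatFunc ℚ)) * coeff d f := by
  have hL : constantCoeff (toRat (L n) * wVar) = RatFunc.X := by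
    rw [map_mul, ← coeff_zero_eq_constantCoeff_apply, coeff_map, coeff_zero_eq_constantCoeff_apply,
      constantCoeff_L, map_one, one_mul, constantCoeff_C]
  have key (e : ℕ) (he : e ≤ d) :
      coeff e (conjOp n f) = (RatFunc.X + (e : RatFunc ℚ)) * coeff e f := by
    rw [conjOp, map_add, coeff_xDeriv, mul_comm (_ * _) f,
      coeff_mul_of_forall_lt fun i hi => hf i (lt_of_lt_of_le hi he), hL]
    ring
  exact ⟨fun e he => by rw [key e he.le, hf e he, mul_zero], key d le_rfl⟩

lemma coeff_iterate_conjOp_of_forall_lt (n m : ℕ) {f : (RatFunc ℚ)⟦X⟧} {d : ℕ}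
    (hf : ∀ e < d, coeff e f = 0) :
    (∀ e < d, coeff e ((conjOp n)^[m] f) = 0) ∧
      coeff d ((conjOp n)^[m] f) = (RatFunc.X + (d : RatFunc ℚ)) ^ m * coeff d f := by
  induction m with
  | zero => simpa using hf
  | succ m ih =>
    rw [Function.iterate_succ_apply']
    obtain ⟨h1, h2⟩ := coeff_conjOp_of_forall_lt n ih.1
    exact ⟨h1, by rw [h2, ih.2]; ring⟩

lemma coeff_fullOp_of_forall_lt {n : ℕ} (hn : 1 ≤ n) {f : (RatFunc ℚ)⟦X⟧} {d : ℕ}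
    (hf : ∀ e < d, coeff e f = 0) : coeff d (fullOp n f) =
      ((RatFunc.X + (d : RatFunc ℚ)) ^ n - RatFunc.X ^ n) * coeff d f := by
  have hc (g : ℚ⟦X⟧) : constantCoeff (toRat g) = algebraMap ℚ (RatFunc ℚ) (constantCoeff g) := by
    rw [← coeff_zero_eq_constantCoeff_apply, coeff_map, coeff_zero_eq_constantCoeff_apply]
  have hsum : ∀ e < d, coeff e (∑ r ∈ Finset.Icc 1 n,
      toRat (C (S r n / (n : ℚ) ^ r)) * (conjOp n)^[n - r] f) = 0 := by
    intro e he
    rw [map_sum]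
    refine Finset.sum_eq_zero fun r _ => ?_
    have h1 := (coeff_iterate_conjOp_of_forall_lt n (n - r) hf).1
    rw [mul_comm, coeff_mul_of_forall_lt fun i hi => h1 i (hi.trans he), h1 e he, zero_mul]
  have hsum' : coeff d (toRat (L n ^ n - 1) * ∑ r ∈ Finset.Icc 1 n,
      toRat (C (S r n / (n : ℚ) ^ r)) * (conjOp n)^[n - r] f) = 0 := by
    rw [mul_comm, coeff_mul_of_forall_lt hsum, hc]
    simp [constantCoeff_L]
  rw [fullOp_eq hn, map_sub, map_sub, hsum', (coeff_iterate_conjOp_of_forall_lt n n hf).2,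
    mul_comm (_ ^ n) f, coeff_mul_of_forall_lt hf, map_pow, map_mul, hc, constantCoeff_L,
    constantCoeff_C, map_one]
  ring

lemma SeriesBigO.fullOp {f : (RatFunc ℚ)⟦X⟧} {c : ℤ} (hf : SeriesBigO f c) (n : ℕ) :
    SeriesBigO (fullOp n f) ((n - 1 : ℕ) + c) := by
  rw [fullOp_apply]
  refine SeriesBigO.sum _ fun k hk => ?_
  have h1 : SeriesBigO ((toRat (L n) * wVar) ^ (n - (k + 1))) ((n - 1 : ℕ) : ℤ) := by
    have h2 := (SeriesBigO.map (L n)).mul (SeriesBigO.C IsBigOAtInfinity.X)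
    refine (h2.pow (n - (k + 1))).mono ?_
    rw [zero_add, mul_one]
    exact_mod_cast (by omega : n - (k + 1) ≤ n - 1)
  refine h1.mul (SeriesBigO.symbolCoeff (SeriesBigO.map _) (SeriesBigO.zero 0) (SeriesBigO.map _)
    (fun r => SeriesBigO.map _) hf n (k + 1))

lemma coeff_iterate_shiftOp (m d : ℕ) (f : (RatFunc ℚ)⟦X⟧) :
    coeff d (shiftOp^[m] f) = (RatFunc.X + (d : RatFunc ℚ)) ^ m * coeff d f := by
  induction m with
  | zero => simp
  | succ m ih =>
    rw [Function.iterate_succ_apply', shiftOp, map_add, coeff_xDeriv, coeff_C_mul, ih]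
    ring

lemma coeff_succ_hyperF {n : ℕ} (hn : 1 ≤ n) (d : ℕ) :
    ((RatFunc.X + ((d + 1 : ℕ) : RatFunc ℚ)) ^ n - RatFunc.X ^ n) * coeff (d + 1) (hyperF n) =
      (∏ r ∈ Finset.Icc 1 n, ((n : RatFunc ℚ) * (RatFunc.X + (d : RatFunc ℚ)) + (r : RatFunc ℚ))) *
        coeff d (hyperF n) := by
  have h0 : ∀ r ∈ Finset.Icc 1 (d + 1), (RatFunc.X + (r : RatFunc ℚ)) ^ n - RatFunc.X ^ n ≠ 0 :=
    fun r hr => (RatFunc_X_add_pow_sub hn (Finset.mem_Icc.mp hr).1).1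
  have h1 := h0 (d + 1) (by simp)
  rw [hyperF, coeff_mk, coeff_mk, Finset.prod_Icc_succ_top (by omega : 1 ≤ d + 1), mul_add n d 1,
    mul_one, prod_Icc_one_eq, Finset.prod_range_add, prod_Icc_one_eq _ (n * d),
    prod_Icc_one_eq _ n]
  have h2 : ∏ r ∈ Finset.Icc 1 d, ((RatFunc.X + (r : RatFunc ℚ)) ^ n - RatFunc.X ^ n) ≠ 0 :=
    Finset.prod_ne_zero_iff.mpr fun r hr => h0 r (by
      rw [Finset.mem_Icc] at hr ⊢
      omega)
  have h3 : ∏ x ∈ Finset.range n,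
      ((n : RatFunc ℚ) * RatFunc.X + ((n * d + x + 1 : ℕ) : RatFunc ℚ)) = ∏ i ∈ Finset.range n,
      ((n : RatFunc ℚ) * (RatFunc.X + (d : RatFunc ℚ)) + ((i + 1 : ℕ) : RatFunc ℚ)) :=
    Finset.prod_congr rfl fun i _ => by push_cast; ring
  rw [h3]
  field_simp

lemma hyperF_eq {n : ℕ} (hn : 1 ≤ n) : shiftOp^[n] (hyperF n) - wVar ^ n * hyperF n =
    toRat (C ((n : ℚ) ^ n) * X) * ∑ r ∈ Finset.range (n + 1),
      toRat (C (S r n / (n : ℚ) ^ r)) * shiftOp^[n - r] (hyperF n) := by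
  have hRHS (d : ℕ) : coeff d (∑ r ∈ Finset.range (n + 1),
      toRat (C (S r n / (n : ℚ) ^ r)) * shiftOp^[n - r] (hyperF n)) =
      (∑ r ∈ Finset.range (n + 1), algebraMap ℚ (RatFunc ℚ) (S r n / (n : ℚ) ^ r) *
        (RatFunc.X + (d : RatFunc ℚ)) ^ (n - r)) * coeff d (hyperF n) := by
    rw [map_sum, Finset.sum_mul]
    refine Finset.sum_congr rfl fun r _ => ?_
    rw [toRat, map_C, coeff_C_mul, coeff_iterate_shiftOp, mul_assoc]
  have hX : toRat (C ((n : ℚ) ^ n) * X) = C (algebraMap ℚ (RatFunc ℚ) ((n : ℚ) ^ n)) * X := by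
    rw [map_mul, map_C, map_X]
  ext d
  rw [map_sub, coeff_iterate_shiftOp, ← map_pow, coeff_C_mul, ← sub_mul, hX, mul_assoc,
    coeff_C_mul]
  rcases d with _ | d
  · simp
  · rw [coeff_succ_X_mul, coeff_succ_hyperF hn, hRHS, ← mul_assoc]
    congr 1
    have h1 := congrArg (Polynomial.aeval (RatFunc.X + (d : RatFunc ℚ))) (sum_S_div_mul_X_pow hn)
    simp only [map_mul, map_sum, map_prod, map_add, map_pow, Polynomial.aeval_C, Polynomial.aeval_X,
      map_natCast] at h1
    rw [map_pow, map_natCast, h1]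

lemma iterate_conjOp_mul {n : ℕ} {mu : ℚ⟦X⟧} (hmu : constantCoeff mu = 0)
    (hmu' : xDeriv ℚ mu = L n - 1) (m : ℕ) (f : (RatFunc ℚ)⟦X⟧) :
    (conjOp n)^[m] (expNegMul mu * f) = expNegMul mu * shiftOp^[m] f := by
  induction m with
  | zero => rfl
  | succ m ih =>
    rw [Function.iterate_succ_apply', Function.iterate_succ_apply', ih, conjOp, shiftOp,
      IntDer.map_mul, xDeriv_expNegMul hmu, hmu', map_sub, map_one]
    ring

lemma fullOp_expNegMul_mul_hyperF {n : ℕ} (hn : 1 ≤ n) {mu : ℚ⟦X⟧} (hmu : constantCoeff mu = 0)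
    (hmu' : xDeriv ℚ mu = L n - 1) : fullOp n (expNegMul mu * hyperF n) = 0 := by
  have h1 := congrArg (fun f => expNegMul mu * f) (hyperF_eq hn)
  simp only [mul_sub, mul_left_comm (expNegMul mu), Finset.mul_sum] at h1
  simp only [← iterate_conjOp_mul hmu hmu', ← Finset.mul_sum] at h1
  rw [Finset.sum_range_succ', ← sum_Icc_one_eq fun r =>
    toRat (C (S r n / (n : ℚ) ^ r)) * (conjOp n)^[n - r] (expNegMul mu * hyperF n)] at h1
  simp only [S_zero, pow_zero, div_one, Nat.sub_zero, map_one, one_mul] at h1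
  have h2 := congrArg toRat (natCast_pow_X_mul_L_pow hn)
  rw [map_mul] at h2
  rw [fullOp_eq hn]
  simp only [mul_pow, map_pow, map_sub, map_one] at h1 h2 ⊢
  linear_combination toRat (L n) ^ n * h1 + (∑ r ∈ Finset.Icc 1 n,
    toRat (C (S r n / (n : ℚ) ^ r)) * (conjOp n)^[n - r] (expNegMul mu * hyperF n) +
      (conjOp n)^[n] (expNegMul mu * hyperF n)) * h2

/-- The truncated expansion `∑_{s < N} Φ_s w⁻ˢ`. -/
noncomputable def partialExp (Phi : ℕ → ℚ⟦X⟧) (N : ℕ) : (RatFunc ℚ)⟦X⟧ :=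
  ∑ s ∈ Finset.range N, C (RatFunc.X⁻¹ ^ s) * toRat (Phi s)

lemma seriesBigO_fullOp_partialExp {n : ℕ} (hn : 1 ≤ n) {Phi : ℕ → ℚ⟦X⟧} (h : SolvesODE n Phi)
    (N : ℕ) : SeriesBigO (fullOp n (partialExp Phi N)) ((n - 1 : ℕ) + (-N : ℤ)) := by
  set v : (RatFunc ℚ)⟦X⟧ := C RatFunc.X⁻¹ with hv
  have hwv : wVar * v = 1 := by
    rw [hv, ← map_mul, mul_inv_cancel₀ RatFunc.X_ne_zero, map_one]
  set B : ℕ → ℕ → (RatFunc ℚ)⟦X⟧ := fun s k =>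
    v ^ (s + k) * toRat ((L n)⁻¹ ^ k * symL n (k + 1) (Phi s)) with hB
  have hB0 (s k : ℕ) (hk : n ≤ k) : B s k = 0 := by
    simp only [hB]
    rw [symL_eq_zero_of_lt (by omega), mul_zero, map_zero, mul_zero]
  have hterm (s k : ℕ) (hk : k < n) : (toRat (L n) * wVar) ^ (n - (k + 1)) *
      symRat n (k + 1) (C (RatFunc.X⁻¹ ^ s) * toRat (Phi s)) =
      (toRat (L n) * wVar) ^ (n - 1) * B s k := by
    simp only [hB]
    rw [symRat_C_mul, symRat_toRat, show n - 1 = n - (k + 1) + k by omega, pow_add _ _ k, map_pow,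
      ← hv, mul_pow _ _ k, map_mul, map_pow]
    have h1 : toRat (L n) ^ k * toRat (L n)⁻¹ ^ k = 1 := by
      rw [← mul_pow, ← map_mul, L_mul_inv, map_one, one_pow]
    have h2 : wVar ^ k * v ^ k = 1 := by rw [← mul_pow, hwv, one_pow]
    rw [pow_add v]
    linear_combination (-(toRat (L n) * wVar) ^ (n - (k + 1)) * v ^ s *
      toRat (symL n (k + 1) (Phi s))) * (h1 * (wVar ^ k * v ^ k) + h2)
  have hsum : fullOp n (partialExp Phi N) = (toRat (L n) * wVar) ^ (n - 1) *
      ∑ s ∈ Finset.range N, ∑ k ∈ Finset.range (n + N), B s k := by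
    rw [partialExp, map_sum, Finset.mul_sum]
    refine Finset.sum_congr rfl fun s _ => ?_
    rw [fullOp_apply, Finset.sum_congr rfl fun k hk => hterm s k (Finset.mem_range.mp hk),
      ← Finset.mul_sum]
    congr 1
    refine Finset.sum_subset (by intro x; simp; omega) fun k _ hk => hB0 s k (by simpa using hk)
  have hdiag : ∑ s ∈ Finset.range N, ∑ k ∈ Finset.range (N - s), B s k = 0 := by
    rw [← Finset.sum_range_diag_flip]
    refine Finset.sum_eq_zero fun m _ => ?_
    have h1 := h.1 m
    rw [odeLHS_eq_sum_antidiagonal hn, ← Finset.Nat.sum_antidiagonal_swap,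
      Finset.Nat.sum_antidiagonal_eq_sum_range_succ_mk] at h1
    have h2 : ∀ k ∈ Finset.range (m + 1), B k (m - k) =
        v ^ m * toRat ((L n)⁻¹ ^ (m - k) * symL n (m - k + 1) (Phi k)) := by
      intro k hk
      simp only [hB]
      rw [Nat.add_sub_cancel' (Nat.lt_succ_iff.mp (Finset.mem_range.mp hk))]
    rw [Finset.sum_congr rfl h2, ← Finset.mul_sum, ← map_sum]
    simp only [Prod.swap] at h1
    rw [h1, map_zero, mul_zero]
  rw [hsum]
  have hw : SeriesBigO ((toRat (L n) * wVar) ^ (n - 1)) ((n - 1 : ℕ) : ℤ) := by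
    have h2 := (SeriesBigO.map (L n)).mul (SeriesBigO.C IsBigOAtInfinity.X)
    simpa using h2.pow (n - 1)
  refine hw.mul ?_
  have hsplit : ∑ s ∈ Finset.range N, ∑ k ∈ Finset.range (n + N), B s k =
      ∑ s ∈ Finset.range N, ∑ k ∈ Finset.Ico (N - s) (n + N), B s k := by
    rw [← zero_add (∑ s ∈ Finset.range N, ∑ k ∈ Finset.Ico (N - s) (n + N), B s k), ← hdiag,
      ← Finset.sum_add_distrib]
    refine Finset.sum_congr rfl fun s _ => ?_
    rw [Finset.sum_range_add_sum_Ico _ (by omega)]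
  rw [hsplit]
  refine SeriesBigO.sum _ fun s _ => SeriesBigO.sum _ fun k hk => ?_
  have h1 := ((SeriesBigO.C IsBigOAtInfinity.inv_X).pow (s + k)).mul
    (SeriesBigO.map ((L n)⁻¹ ^ k * symL n (k + 1) (Phi s)))
  refine h1.mono ?_
  have := (Finset.mem_Ico.mp hk).1
  push_cast
  omega

lemma SolvesODE.hasExpansion {n : ℕ} (hn : 1 ≤ n) {Phi : ℕ → ℚ⟦X⟧} (h : SolvesODE n Phi) :
    ∃ mu, HasExpansion n mu Phi := by
  set mu : ℚ⟦X⟧ := PowerSeries.mk fun d => coeff d (L n) / d with hmu_def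
  have hmu : constantCoeff mu = 0 := by
    rw [← coeff_zero_eq_constantCoeff_apply, coeff_mk]
    simp
  have hmu' : xDeriv ℚ mu = L n - 1 := by
    ext d
    rw [coeff_xDeriv, hmu_def, coeff_mk, map_sub, coeff_one]
    rcases d with _ | d
    · simp [constantCoeff_L]
    · have : ((d + 1 : ℕ) : ℚ) ≠ 0 := by positivity
      rw [if_neg (Nat.succ_ne_zero d), sub_zero]
      field_simp
  have hmain (N : ℕ) (hN : 1 ≤ N) :
      SeriesBigO (expNegMul mu * hyperF n - partialExp Phi N) (-N : ℤ) := by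
    set E := expNegMul mu * hyperF n - partialExp Phi N with hE
    have hPE : SeriesBigO (fullOp n E) ((n - 1 : ℕ) + (-N : ℤ)) := by
      rw [hE, map_sub, fullOp_expNegMul_mul_hyperF hn hmu hmu', zero_sub]
      exact (seriesBigO_fullOp_partialExp hn h N).neg
    intro d
    induction d using Nat.strong_induction_on with
    | _ d ih =>
      rcases Nat.eq_zero_or_pos d with rfl | hd
      · have h0 : coeff 0 E = 0 := by
          have hpart : coeff 0 (partialExp Phi N) = 1 := by
            rw [partialExp, map_sum, Finset.sum_eq_single 0]
            · simp [h.2]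
            · intro s _ hs
              rw [coeff_C_mul, coeff_map, coeff_zero_eq_constantCoeff_apply, h.2, if_neg hs,
                map_zero, mul_zero]
            · intro h0
              exact absurd (Finset.mem_range.mpr hN) h0
          rw [hE, map_sub, hpart, coeff_zero_eq_constantCoeff_apply, map_mul,
            constantCoeff_expNegMul hmu, constantCoeff_hyperF, one_mul, sub_self]
        rw [h0]
        exact IsBigOAtInfinity.zero _
      · set E' : (RatFunc ℚ)⟦X⟧ := PowerSeries.mk fun e => if e < d then coeff e E else 0 with hE'
        have hE'O : SeriesBigO E' (-N : ℤ) := by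
          intro e
          rw [hE', coeff_mk]
          split_ifs with he
          · exact ih e he
          · exact IsBigOAtInfinity.zero _
        have h1 : ∀ e < d, coeff e (E - E') = 0 := by
          intro e he
          rw [map_sub, hE', coeff_mk, if_pos he, sub_self]
        have h2 := coeff_fullOp_of_forall_lt hn h1
        have h3 : coeff d (E - E') = coeff d E := by
          rw [map_sub, hE', coeff_mk, if_neg (lt_irrefl d), sub_zero]
        obtain ⟨h4, h5⟩ := RatFunc_X_add_pow_sub hn hd
        refine IsBigOAtInfinity.of_mul h4 h5 ?_
        rw [← h3, ← h2, map_sub]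
        exact hPE.sub (hE'O.fullOp n) d
  refine ⟨mu, hmu, fun d N => ?_⟩
  have hC : (algebraMap ℚ (RatFunc ℚ)) = RatFunc.C := Subsingleton.elim _ _
  have hcoeff (N : ℕ) : coeff d (partialExp Phi N) = ∑ s ∈ Finset.range N,
      RatFunc.C (coeff d (Phi s)) * (RatFunc.X⁻¹) ^ s := by
    rw [partialExp, map_sum]
    refine Finset.sum_congr rfl fun s _ => ?_
    rw [coeff_C_mul, coeff_map, hC, mul_comm]
  rcases Nat.eq_zero_or_pos N with rfl | hN
  · have h1 := (hmain 1 le_rfl d).mono (l := 0) (by norm_num)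
    rw [map_sub, hcoeff] at h1
    have h2 := h1.add (IsBigOAtInfinity.C (coeff d (Phi 0)))
    simpa using h2
  · rw [← hcoeff, ← map_sub]
    exact hmain N hN d

end Expansion

end MirrorHG

theorem theorem4 :
    -- the expansion defining `μ` and the `Φ_s` exists and is unique
    (∀ n : ℕ, 1 ≤ n → ∃! p : PowerSeries ℚ × (ℕ → PowerSeries ℚ),
      MirrorHG.HasExpansion n p.1 p.2) ∧
    -- (i)
    (∀ n : ℕ, 1 ≤ n → ∀ (mu : PowerSeries ℚ) (Phi : ℕ → PowerSeries ℚ),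
      MirrorHG.HasExpansion n mu Phi →
        MirrorHG.SolvesODE n Phi ∧
          ∀ Phi' : ℕ → PowerSeries ℚ, MirrorHG.SolvesODE n Phi' → Phi' = Phi) ∧
    -- (ii)
    (∀ n : ℕ, 1 ≤ n → ∀ (mu : PowerSeries ℚ) (Phi : ℕ → PowerSeries ℚ),
      MirrorHG.HasExpansion n mu Phi →
        ∀ s : ℕ, ∃ P : Polynomial ℚ,
          Phi s = MirrorHG.L n * Polynomial.aeval (MirrorHG.L n) P) ∧
    -- (iii)
    (∀ s : ℕ, ∃ Psi : MvPolynomial (Fin 3) (RatFunc ℚ),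
      ∀ n : ℕ, 1 ≤ n → MirrorHG.RegularAt Psi (n : ℚ) ∧
        ∀ (mu : PowerSeries ℚ) (Phi : ℕ → PowerSeries ℚ), MirrorHG.HasExpansion n mu Phi →
          Phi s = MirrorHG.evalAt Psi (n : ℚ) (MirrorHG.L n) ((MirrorHG.L n)⁻¹)
            (MirrorHG.L n ^ n)) := by
  obtain ⟨Phi₀, hODE, hpoly, hunif⟩ := MirrorHG.exists_uniform_solution
  have hexp (n : ℕ) (hn : 1 ≤ n) : ∃ mu, MirrorHG.HasExpansion n mu (Phi₀ n) :=
    (hODE n hn).hasExpansion hn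
  have heq (n : ℕ) (hn : 1 ≤ n) (mu : PowerSeries ℚ) (Phi : ℕ → PowerSeries ℚ)
      (h : MirrorHG.HasExpansion n mu Phi) : Phi = Phi₀ n := by
    obtain ⟨mu₀, hmu₀⟩ := hexp n hn
    exact (hmu₀.unique h).2
  refine ⟨fun n hn => ?_, fun n hn mu Phi h => ?_, fun n hn mu Phi h s => ?_, fun s => ?_⟩
  · obtain ⟨mu, hmu⟩ := hexp n hn
    exact ⟨(mu, Phi₀ n), hmu, fun p hp => Prod.ext (hmu.unique hp).1 (hmu.unique hp).2⟩
  · rw [heq n hn mu Phi h]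
    exact ⟨hODE n hn, fun Phi' h' => (hODE n hn).unique hn h'⟩
  · rw [heq n hn mu Phi h]
    exact hpoly n hn s
  · obtain ⟨Psi, hPsi⟩ := hunif s
    refine ⟨Psi, fun n hn => ⟨(hPsi n hn).1, fun mu Phi h => ?_⟩⟩
    rw [heq n hn mu Phi h]
    exact (hPsi n hn).2
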